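/- Let $\Sigma$ (characters) and $\mathbb X$ (word variables) be finite disjoint sets, $\Sigma_{\mathbb X}=\Sigma\cup\mathbb X$, let $\square\notin\Sigma_{\mathbb X}$ be a padding symbol, $\Gamma=(\Sigma_{\mathbb X}\cup\{\square\})^2$ and $\bot=(\square,\square)\in\Gamma$. A word equation $e$ is a pair $(\ell,r)$ of words over $\Sigma_{\mathbb X}$; a model of $e$ is a map $I:\mathbb X\to\Sigma^*$ whose homomorphic extension (the identity on $\Sigma$) satisfies $I(\ell)=I(r)$; $e$ is quadratic if every variable occurs at most twice in $\ell r$. **Encoding.** $\mathrm{eqenc}(\ell,r)\in\Gamma^*$ is the two-track word with $\ell$ and $r$ on its tracks, the shorter one filled up with $\square$. $\mathrm{trim}(w)$ removes from $w\in\Gamma^*$ the maximal prefix of symbols $(\beta,\beta)$. Put $\mathrm{encode}(e)=\{\mathrm{trim}(\mathrm{eqenc}(e)\bot^k): k\ge 0\}$ and $\mathrm{satur}(L)=\{u : u\bot^k\in L\text{ for some }k\ge 0\}$. **Rules.** For $x\in\mathbb X$ and $\alpha\in\Sigma_{\mathbb X}$, the Nielsen rule $x\hookrightarrow\alpha x$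 applies to $e$ if one side starts with $x$ and the other one with $\alpha$, and replaces all $x$ by $\alpha x$; the rule $x\hookrightarrow\varepsilon$ applies if some side starts with $x$, and deletes all $x$; after either of them the longest common prefix of the two sides is removed. For a rule $\rho$ and a word $w$ that encodes an equation $e$ whose sides do not start with the same symbol, $w[\rho]=\mathrm{encode}(\rho(e))$, which is empty if $\rho$ does not apply to $e$. On encodings, the rules are the binary relations $T^{\le 2}_{x\hookrightarrow\alpha x}$ and $T^{\le 2}_{x\hookrightarrow\varepsilon}$ on $\Gamma^*$: a two-track word that satisfies the condition on first symbols and has at most two occurrences of $x$ on both tracks together is transformed on each track by a length-preserving substitution and is then trimmed. For $x\mapsto\varepsilon$ with $n$ occurrences on a track, these are deleted, the other symbols move to the left, and the last $n$ positions of the result are filled with $\square$. For $x\mapsto\alpha x$, the last $n$ positions of the input track have to be $\square$, and they give room for the $n$ inserted symbols $\alpha$. Let $$\mathcal I^e=\mathrm{encode}(e),\qquad \mathcal T^e_{x\hookrightarrow\alpha x}=\bigcup_{y\in\mathbb X,\,\alpha\in\Sigma_{\mathbb X}}T^{\le 2}_{y\hookrightarrow\alpha y},\qquad \mathcal T^e_{x\hookrightarrow\varepsilon}=\bigcup_{y\in\mathbb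 X}T^{\le 2}_{y\hookrightarrow\varepsilon},\qquad \mathcal D^e=\{\bot\}^*,$$ and $\mathcal T=\mathcal T^e_{x\hookrightarrow\alpha x}\cup\mathcal T^e_{x\hookrightarrow\varepsilon}$. **Algorithm 1.** Start with $\mathit{reach}_0=\mathcal I^e$, $\mathit{processed}=\emptyset$, $i=0$. While $\mathit{reach}_i\not\subseteq\mathit{processed}$: if $\mathcal D^e\cap\mathit{reach}_i\ne\emptyset$, extract and return a model; otherwise add $\mathit{reach}_i$ to $\mathit{processed}$, put $\mathit{reach}_{i+1}=\mathrm{satur}(\mathcal T(\mathit{reach}_i))$ and increase $i$. If the loop ends, return false. The extraction starts with $I(x)=\varepsilon$ for all $x\in\mathbb X$ and some $w_i\in\mathcal D^e\cap\mathit{reach}_i$; for $j=i,\dots,1$ it chooses some $w_{j-1}\in\mathit{reach}_{j-1}$ with $w_j\in\mathrm{satur}(\mathcal T(\{w_{j-1}\}))$ and then some rule $\rho$ with $w_j\in w_{j-1}[\rho]$, and if $\rho$ is $y\hookrightarrow\alpha y$ it sets $I(y):=I(\alpha)I(y)$; finally it returns $I$. All choices are arbitrary. **Lemma.** Let $e$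 be a quadratic word equation. Then $\mathcal I^e$ and $\mathcal D^e$ are regular languages, $\mathcal T^e_{x\hookrightarrow\alpha x}$ and $\mathcal T^e_{x\hookrightarrow\varepsilon}$ are rational relations (accepted by finite 2-tape transducers), all sets $\mathit{reach}_i$ and $\mathit{processed}$ that the algorithm computes are regular, and Algorithm 1 instantiated with $(\mathcal I^e,\mathcal T^e_{x\hookrightarrow\alpha x}\cup\mathcal T^e_{x\hookrightarrow\varepsilon},\mathcal D^e)$ is 1. sound: every assignment that it returns is a model of $e$; 2. complete: if $e$ has a model, then, whatever choices are made, it returns a model of $e$ after a finite number of steps; 3. terminating: whatever choices are made, it returns an assignment or false after a finite number of steps. -/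

import Mathlib

namespace WordEq

universe u v

/-! ### Word equations -/

/-- Symbols of word terms: `Sum.inl a` is a character, `Sum.inr x` a word variable. -/
abbrev Sym (S : Type u) (V : Type v) := S ⊕ V

/-- A word equation `lhs = rhs` between two word terms. -/
@[ext]
structure WordEquation (S : Type u) (V : Type v) where
  lhs : List (Sym S V)
  rhs : List (Sym S V)

/-- An assignment of words to the word variables. -/
abbrev Assignment (S : Type u) (V : Type v) := V → List S

/-- The value of a symbol under an assignment (characters are interpreted as themselves). -/
def Assignment.evalSym {S : Type u} {V : Type v} (I : Assignment S V) : Sym S V → List S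
  | Sum.inl a => [a]
  | Sum.inr x => I x

/-- The homomorphic extension of an assignment to word terms. -/
def Assignment.eval {S : Type u} {V : Type v} (I : Assignment S V) (t : List (Sym S V)) :
    List S :=
  t.flatMap I.evalSym

/-- `I` is a model of the equation `e`. -/
def IsModel {S : Type u} {V : Type v} (e : WordEquation S V) (I : Assignment S V) : Prop :=
  I.eval e.lhs = I.eval e.rhs

/-- Every variable has at most two occurrences in the equation. -/
def WordEquation.Quadratic {S : Type u} {V : Type v} [DecidableEq S] [DecidableEq V]
    (e : WordEquation S V) : Prop :=
  ∀ x : V, (e.lhs ++ e.rhs).count (Sum.inr x) ≤ 2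

/-! ### The Nielsen rules on word equations -/

/-- The Nielsen rules: `prepend x α` is the rule `x ↪ αx`, and `erase x` is the rule `x ↪ ε`. -/
inductive NielsenRule (S : Type u) (V : Type v) where
  | prepend (x : V) (α : Sym S V) : NielsenRule S V
  | erase (x : V) : NielsenRule S V

/-- The term `t[x / r]`: all occurrences of the variable `x` are replaced by `r`. -/
def substTerm {S : Type u} {V : Type v} [DecidableEq S] [DecidableEq V]
    (x : V) (r : List (Sym S V)) (t : List (Sym S V)) : List (Sym S V) :=
  t.flatMap fun s => if s = Sum.inr x then r else [s]

/-- The substitution `x ↦ r` on both sides of an equation. -/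
def WordEquation.subst {S : Type u} {V : Type v} [DecidableEq S] [DecidableEq V]
    (x : V) (r : List (Sym S V)) (e : WordEquation S V) : WordEquation S V :=
  ⟨substTerm x r e.lhs, substTerm x r e.rhs⟩

/-- Removal of the longest common prefix of two word terms. -/
def trimPair {S : Type u} {V : Type v} [DecidableEq S] [DecidableEq V] :
    List (Sym S V) → List (Sym S V) → List (Sym S V) × List (Sym S V)
  | a :: l, b :: r => if a = b then trimPair l r else (a :: l, b :: r)
  | l, r => (l, r)

/-- Removal of the longest common prefix of the two sides of an equation. -/
def WordEquation.trim {S : Type u} {V : Type v} [DecidableEq S] [DecidableEq V]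
    (e : WordEquation S V) : WordEquation S V :=
  ⟨(trimPair e.lhs e.rhs).1, (trimPair e.lhs e.rhs).2⟩

/-- The two sides do not start with the same symbol. -/
def WordEquation.Reduced {S : Type u} {V : Type v} (e : WordEquation S V) : Prop :=
  ∀ a ∈ e.lhs.head?, a ∉ e.rhs.head?

/-- `Nielsen ρ e e'`: the rule `ρ` is applicable to `e`, and `e'` is the result of applying it
and then trimming. -/
def Nielsen {S : Type u} {V : Type v} [DecidableEq S] [DecidableEq V] :
    NielsenRule S V → WordEquation S V → WordEquation S V → Prop
  | .prepend x α, e, e' =>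
      ((e.lhs.head? = some (Sum.inr x) ∧ e.rhs.head? = some α) ∨
        (e.lhs.head? = some α ∧ e.rhs.head? = some (Sum.inr x))) ∧
      e' = (e.subst x [α, Sum.inr x]).trim
  | .erase x, e, e' =>
      (e.lhs.head? = some (Sum.inr x) ∨ e.rhs.head? = some (Sum.inr x)) ∧
      e' = (e.subst x []).trim

/-! ### Regular languages and rational relations -/

/-- A set of words is regular. -/
def IsRegularSet {B : Type u} (L : Set (List B)) : Prop :=
  Language.IsRegular (show Language B from L)

/-- A 2-tape transducer over the alphabet `B` with states `Q`; the label `none` is `ε`. -/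
structure Transducer (B : Type u) (Q : Type v) where
  trans : Q → Option B → Option B → Q → Prop
  initial : Set Q
  final : Set Q

/-- Runs of a transducer, labelled with the words on its two tapes. -/
inductive Transducer.Run {B : Type u} {Q : Type v} (T : Transducer B Q) :
    Q → List B → List B → Q → Prop
  | nil (q : Q) : Transducer.Run T q [] [] q
  | cons {q r s : Q} {a b : Option B} {w w' : List B} :
      T.trans q a b r → Transducer.Run T r w w' s →
      Transducer.Run T q (a.toList ++ w) (b.toList ++ w') s

/-- The pair `(w, w')` is accepted by the transducer. -/
def Transducer.Accepts {B : Type u} {Q : Type v} (T : Transducer B Q) (w w' : List B) : Prop :=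
  ∃ q ∈ T.initial, ∃ r ∈ T.final, T.Run q w w' r

/-- A binary relation on words is rational if it is accepted by a finite 2-tape transducer. -/
def IsRational {B : Type u} (R : List B → List B → Prop) : Prop :=
  ∃ (Q : Type) (_ : Finite Q) (T : Transducer B Q), ∀ w w', R w w' ↔ T.Accepts w w'

/-- The image of a language under a binary relation. -/
def image {B : Type u} (R : List B → List B → Prop) (L : Set (List B)) : Set (List B) :=
  {w' | ∃ w ∈ L, R w w'}

/-! ### The padded two-track encoding of equations -/

/-- Symbols extended by the padding symbol. -/
abbrev PadSym (S : Type u) (V : Type v) := Option (Sym S V)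

/-- The padding symbol. -/
abbrev pad {S : Type u} {V : Type v} : PadSym S V := none

/-- The two-track alphabet. -/
abbrev Track (S : Type u) (V : Type v) := PadSym S V × PadSym S V

/-- The two-track padding symbol. -/
abbrev pad2 {S : Type u} {V : Type v} : Track S V := (pad, pad)

/-- The equation encoding: the two sides are written on the two tracks, and the shorter one is
filled up with padding symbols. -/
def eqEncode {S : Type u} {V : Type v} (e : WordEquation S V) : List (Track S V) :=
  List.zipWithAll (fun a b => ((a, b) : Track S V)) e.lhs e.rhs

/-- The trimming transduction: the maximal prefix of symbols of the form `(β, β)` (where `β` may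
be the padding symbol) is removed. -/
def trimWord {S : Type u} {V : Type v} [DecidableEq S] [DecidableEq V]
    (w : List (Track S V)) : List (Track S V) :=
  w.dropWhile fun p => decide (p.1 = p.2)

/-- The language of all encodings of an equation: encode, add arbitrary padding, trim. -/
def encode {S : Type u} {V : Type v} [DecidableEq S] [DecidableEq V]
    (e : WordEquation S V) : Set (List (Track S V)) :=
  {w | ∃ k : ℕ, w = trimWord (eqEncode e ++ List.replicate k pad2)}

/-- `satur L`: the words obtained from words of `L` by removing some of the final two-track
padding symbols. -/
def satur {S : Type u} {V : Type v} (L : Set (List (Track S V))) : Set (List (Track S V)) :=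
  {w | ∃ k : ℕ, w ++ List.replicate k pad2 ∈ L}

/-! ### The Nielsen rules on encodings -/

/-- `i 0 < i 1 < ⋯ < i (n-1)` are all the positions of the variable `x` in `w`
(positions are counted from `0`). -/
def Occurrences {S : Type u} {V : Type v} {n : ℕ} (x : V) (w : List (PadSym S V))
    (i : Fin n → ℕ) : Prop :=
  StrictMono i ∧ (∀ k, w[i k]? = some (some (Sum.inr x))) ∧
    ∀ j, w[j]? = some (some (Sum.inr x)) → ∃ k, j = i k

/-- The length-preserving substitution `x ↦ ε` on one track, for exactly `n` occurrences of `x`.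
A symbol different from `x` moves to the left by the number of occurrences before it, and the
last `n` positions of `w'` are filled with padding. -/
def PsiErase {S : Type u} {V : Type v} (n : ℕ) (x : V) (w w' : List (PadSym S V)) : Prop :=
  w.length = w'.length ∧ ∃ i : Fin n → ℕ, Occurrences x w i ∧
    (∀ j < w.length, (∀ k, j ≠ i k) →
      w'[j - (Finset.univ.filter fun k => i k < j).card]? = w[j]?) ∧
    (∀ j < w.length, w.length - n ≤ j → w'[j]? = some pad)

/-- The length-preserving substitution `x ↦ αx` on one track, for exactly `n` occurrences of `x`.
A symbol moves to the right by the number of occurrences up to and including its own position,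
`α` is written immediately before each of the moved `x`, and the last `n` positions of `w` are
padding (so that there is room). -/
def PsiPrepend {S : Type u} {V : Type v} (n : ℕ) (x : V) (α : Sym S V)
    (w w' : List (PadSym S V)) : Prop :=
  w.length = w'.length ∧ ∃ i : Fin n → ℕ, Occurrences x w i ∧
    (∀ k : Fin n, w'[i k + (k : ℕ)]? = some (some α)) ∧
    (∀ j, j + (Finset.univ.filter fun k => i k ≤ j).card < w.length →
      w'[j + (Finset.univ.filter fun k => i k ≤ j).card]? = w[j]?) ∧
    (∀ j < w.length, w.length - n ≤ j → w[j]? = some pad)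

/-- The rule `x ↪ ε` before trimming, on two-track words with at most `n` occurrences of `x`. -/
def PhiErase {S : Type u} {V : Type v} (n : ℕ) (x : V) (w w' : List (Track S V)) : Prop :=
  ((w.map Prod.fst).head? = some (some (Sum.inr x)) ∨
    (w.map Prod.snd).head? = some (some (Sum.inr x))) ∧
  ∃ m ≤ n, ∃ k ≤ m,
    PsiErase k x (w.map Prod.fst) (w'.map Prod.fst) ∧
    PsiErase (m - k) x (w.map Prod.snd) (w'.map Prod.snd)

/-- The rule `x ↪ αx` before trimming, on two-track words with at most `n` occurrences of `x`. -/
def PhiPrepend {S : Type u} {V : Type v} (n : ℕ) (x : V) (α : Sym S V)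
    (w w' : List (Track S V)) : Prop :=
  (((w.map Prod.fst).head? = some (some (Sum.inr x)) ∧
      (w.map Prod.snd).head? = some (some α)) ∨
    ((w.map Prod.fst).head? = some (some α) ∧
      (w.map Prod.snd).head? = some (some (Sum.inr x)))) ∧
  ∃ m ≤ n, ∃ k ≤ m,
    PsiPrepend k x α (w.map Prod.fst) (w'.map Prod.fst) ∧
    PsiPrepend (m - k) x α (w.map Prod.snd) (w'.map Prod.snd)

/-- The relation `T^{≤n}` of the rule `x ↪ ε`, including trimming. -/
def TErase {S : Type u} {V : Type v} [DecidableEq S] [DecidableEq V] (n : ℕ) (x : V)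
    (w w' : List (Track S V)) : Prop :=
  ∃ z, PhiErase n x w z ∧ w' = trimWord z

/-- The relation `T^{≤n}` of the rule `x ↪ αx`, including trimming. -/
def TPrepend {S : Type u} {V : Type v} [DecidableEq S] [DecidableEq V] (n : ℕ) (x : V)
    (α : Sym S V) (w w' : List (Track S V)) : Prop :=
  ∃ z, PhiPrepend n x α w z ∧ w' = trimWord z

/-- `w[ρ]`: the encodings of the equation that the rule `ρ` produces from the (reduced) equation
encoded by `w`. -/
def ruleImage {S : Type u} {V : Type v} [DecidableEq S] [DecidableEq V]
    (ρ : NielsenRule S V) (w : List (Track S V)) : Set (List (Track S V)) :=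
  {w' | ∃ e e' : WordEquation S V,
    e.Reduced ∧ w ∈ encode e ∧ Nielsen ρ e e' ∧ w' ∈ encode e'}

/-! ### The algorithm -/

/-- The input of the algorithm: the initial set, the two transformers and the destination set. -/
structure RMCProblem (S : Type u) (V : Type v) where
  init : Set (List (Track S V))
  transPrepend : List (Track S V) → List (Track S V) → Prop
  transErase : List (Track S V) → List (Track S V) → Prop
  dest : Set (List (Track S V))

/-- The languages of the input are regular and its relations are rational. -/
def RMCProblem.IsEffective {S : Type u} {V : Type v} (P : RMCProblem S V) : Prop :=
  IsRegularSet P.init ∧ IsRational P.transPrepend ∧ IsRational P.transErase ∧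
    IsRegularSet P.dest

/-- The union of the two transformers. -/
def RMCProblem.trans {S : Type u} {V : Type v} (P : RMCProblem S V)
    (w w' : List (Track S V)) : Prop :=
  P.transPrepend w w' ∨ P.transErase w w'

/-- The states of the algorithm. -/
inductive AlgState (S : Type u) (V : Type v) where
  /-- The head of the main loop: the set of processed words, the current set `reach i`, and the
  list `[reach (i-1), …, reach 0]` of the previous ones. -/
  | loop (processed reach : Set (List (Track S V))) (previous : List (Set (List (Track S V))))
  /-- The head of the loop of the model extraction: the assignment computed so far, the current
  word `w ℓ`, and the list `[reach (ℓ-1), …, reach 0]`. -/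
  | extract (I : Assignment S V) (w : List (Track S V)) (previous : List (Set (List (Track S V))))
  /-- The model extraction after the predecessor `w'` of `w` has been chosen. -/
  | chooseRule (I : Assignment S V) (w' w : List (Track S V))
      (previous : List (Set (List (Track S V))))
  /-- The algorithm has returned: an assignment `some I`, or `none` for `false`. -/
  | returned (result : Option (Assignment S V))

/-- The update of the assignment in the model extraction. -/
def extractUpdate {S : Type u} {V : Type v} [DecidableEq V] (I : Assignment S V) :
    NielsenRule S V → Assignment S V
  | .prepend y α => Function.update I y (I.evalSym α ++ I y)
  | .erase _ => I

/-- The steps of the algorithm. All choices ("let `w` be some element such that …") are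
nondeterministic. -/
inductive AlgStep {S : Type u} {V : Type v} [DecidableEq S] [DecidableEq V]
    (P : RMCProblem S V) : AlgState S V → AlgState S V → Prop
  /-- The loop condition fails: return `false`. -/
  | exhausted {processed reach previous} :
      reach ⊆ processed →
      AlgStep P (.loop processed reach previous) (.returned none)
  /-- The destination set is reached: start the model extraction at a word of `dest ∩ reach i`,
  from the assignment that maps all variables to `ε`. -/
  | found {processed reach previous w} :
      ¬ reach ⊆ processed → w ∈ P.dest ∩ reach →
      AlgStep P (.loop processed reach previous) (.extract (fun _ => []) w previous)
  /-- Otherwise compute the next set of reachable words. -/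
  | advance {processed reach previous} :
      ¬ reach ⊆ processed → ¬ (P.dest ∩ reach).Nonempty →
      AlgStep P (.loop processed reach previous)
        (.loop (processed ∪ reach) (satur (image P.trans reach)) (reach :: previous))
  /-- Choose a predecessor of `w` in the previous set of reachable words. -/
  | back {I w' w reach previous} :
      w' ∈ reach → w ∈ satur (image P.trans {w'}) →
      AlgStep P (.extract I w (reach :: previous)) (.chooseRule I w' w previous)
  /-- Choose a rule that leads from `w'` to `w`, and update the assignment. -/
  | rule {I w' w previous ρ} :
      w ∈ ruleImage ρ w' →
      AlgStep P (.chooseRule I w' w previous) (.extract (extractUpdate I ρ) w' previous)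
  /-- The initial set has been reached: return the assignment. -/
  | finish {I w} :
      AlgStep P (.extract I w []) (.returned (some I))

/-- The initial state of the algorithm. -/
def RMCProblem.start {S : Type u} {V : Type v} (P : RMCProblem S V) : AlgState S V :=
  .loop ∅ P.init []

/-- Whatever choices are made, after at most `n` steps from the state `s` a state that satisfies
`G` has been reached; in particular no run gets stuck before. -/
def InevitableWithin {σ : Type u} (step : σ → σ → Prop) (G : σ → Prop) : ℕ → σ → Prop
  | 0, s => G s
  | n + 1, s => G s ∨ ((∃ t, step s t) ∧ ∀ t, step s t → InevitableWithin step G n t)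

/-- Every assignment that the algorithm can return is a model. -/
def RMCProblem.Sound {S : Type u} {V : Type v} [DecidableEq S] [DecidableEq V]
    (P : RMCProblem S V) (Model : Assignment S V → Prop) : Prop :=
  ∀ I, Relation.ReflTransGen (AlgStep P) P.start (.returned (some I)) → Model I

/-- If there is a model, then the algorithm returns a model in a finite number of steps. -/
def RMCProblem.Complete {S : Type u} {V : Type v} [DecidableEq S] [DecidableEq V]
    (P : RMCProblem S V) (Model : Assignment S V → Prop) : Prop :=
  (∃ J, Model J) →
    ∃ n, InevitableWithin (AlgStep P) (fun s => ∃ I, s = .returned (some I) ∧ Model I) n P.start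

/-- The algorithm always returns an assignment or `false` in a finite number of steps. -/
def RMCProblem.Terminating {S : Type u} {V : Type v} [DecidableEq S] [DecidableEq V]
    (P : RMCProblem S V) : Prop :=
  ∃ n, InevitableWithin (AlgStep P) (fun s => ∃ result, s = .returned result) n P.start

/-- All sets that the algorithm computes are regular languages. -/
def RMCProblem.Symbolic {S : Type u} {V : Type v} [DecidableEq S] [DecidableEq V]
    (P : RMCProblem S V) : Prop :=
  ∀ processed reach previous,
    Relation.ReflTransGen (AlgStep P) P.start (.loop processed reach previous) →
      IsRegularSet processed ∧ IsRegularSet reach ∧ ∀ R ∈ previous, IsRegularSet R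

/-- The instantiation for a single equation: the encodings of `e` as the initial set, the unions
of the relations `T^{≤2}` over all variables and symbols as the transformers, and the words of
padding as the destination set. -/
def equationProblem {S : Type u} {V : Type v} [DecidableEq S] [DecidableEq V]
    (e : WordEquation S V) : RMCProblem S V where
  init := encode e
  transPrepend := fun w w' => ∃ (y : V) (α : Sym S V), TPrepend 2 y α w w'
  transErase := fun w w' => ∃ y : V, TErase 2 y w w'
  dest := {w | ∃ k : ℕ, w = List.replicate k pad2}

end WordEq

namespace WordEq

/-! ### Closure properties of regular languages -/

section Regular

/-! On words, the algorithm is a breadth-first search in the graph of Nielsen transformations. Every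
reduced equation has an encoding, and `decode` recovers the equation from each of its encodings. So
the languages `encodeSet E`, for sets `E` of reduced equations, are ordered by inclusion exactly as
the sets `E` are, and one round of transducer and saturation computes exactly `nielsenSucc`
(`satur_image_encodeSet`). Saturation compensates for the padding that `x ↪ αx` consumes: a given
result is produced from an input with enough additional padding, and the surplus is cut off
afterwards.

On a reduced quadratic equation no rule increases the size: `x ↪ αx` inserts at most two symbols,
but then both sides start with `α` and trimming removes two (`Nielsen.prepend_bounds`). Hence only
finitely many equations are reachable. The computed sets are therefore finite unions of regular
languages, and since every round that continues contributes a new equation, the number of rounds is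
bounded.

A model of a nontrivial reduced equation selects a rule that leads to an equation with a model for
which the total length of the values plus the size of the equation is smaller
(`exists_nielsen_of_isModel`), so the trivial equation is reached. Conversely, the extraction pulls
models back along a path of rules. As it does not touch the assignment at `x ↪ ε`, it has to carry
the stronger property `IsNarrowModel`, which forces absent variables to have the value `ε`. One
invariant of states and one decreasing rank cover all nondeterministic choices at once.

The transformers are rational because each track substitution preserves length and shifts letters by
a bounded amount: the pairs of input and output, read letter by letter, are recognized with a
bounded queue (`isRegularSet_queue`), and trimming costs one more bit of state. -/

theorem isRegularSet_foldl {B σ : Type*} (δ : σ → B → σ) (s : σ) (F : Set σ) (Q : Set σ)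
    (hQ : Q.Finite) (hs : s ∈ Q) (hδ : ∀ q ∈ Q, ∀ a, δ q a ∈ Q) :
    IsRegularSet {u | List.foldl δ s u ∈ F} := by
  -- By Myhill–Nerode only the reachable states matter: each left quotient is the language accepted
  -- from a state in `Q`, so `σ` may be infinite.
  apply Language.IsRegular.of_finite_range_leftQuotient
  refine (hQ.image fun q => ({v | List.foldl δ q v ∈ F} : Language B)).subset ?_
  rintro _ ⟨u, rfl⟩
  refine ⟨List.foldl δ s u, ?_, ?_⟩
  · have : ∀ (u : List B), ∀ q ∈ Q, List.foldl δ q u ∈ Q := by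
      intro u
      induction u with
      | nil => exact fun q hq => hq
      | cons a u ih => exact fun q hq => ih _ (hδ q hq a)
    exact this u s hs
  · ext v
    change List.foldl δ (List.foldl δ s u) v ∈ F ↔ List.foldl δ s (u ++ v) ∈ F
    rw [List.foldl_append]

theorem IsRegularSet.comap {B C : Type*} {L : Set (List C)} (hL : IsRegularSet L) (f : B → C) :
    IsRegularSet {u : List B | u.map f ∈ L} := by
  obtain ⟨σ, _, M, hM⟩ := hL
  refine ⟨σ, ‹_›, M.comap f, ?_⟩
  rw [DFA.accepts_comap, hM]
  rfl

theorem IsRegularSet.inter {B : Type*} {L₁ L₂ : Set (List B)} (h₁ : IsRegularSet L₁)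
    (h₂ : IsRegularSet L₂) : IsRegularSet (L₁ ∩ L₂) :=
  Language.IsRegular.inf h₁ h₂

theorem IsRegularSet.union {B : Type*} {L₁ L₂ : Set (List B)} (h₁ : IsRegularSet L₁)
    (h₂ : IsRegularSet L₂) : IsRegularSet (L₁ ∪ L₂) :=
  Language.IsRegular.add h₁ h₂

theorem isRegularSet_empty {B : Type*} : IsRegularSet (∅ : Set (List B)) := by
  simpa using isRegularSet_foldl (fun (_ : Unit) (_ : B) => ()) () ∅ {()} (Set.finite_singleton _)
    (by simp) (by simp)

theorem isRegularSet_biUnion {B ι : Type*} {s : Set ι} (hs : s.Finite) {L : ι → Set (List B)}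
    (h : ∀ i ∈ s, IsRegularSet (L i)) : IsRegularSet (⋃ i ∈ s, L i) := by
  induction s, hs using Set.Finite.induction_on with
  | empty => simpa using isRegularSet_empty
  | insert _ _ ih =>
    rw [Set.biUnion_insert]
    exact (h _ (Set.mem_insert _ _)).union (ih fun i hi => h i (Set.mem_insert_of_mem _ hi))

theorem isRegularSet_setOf_exists {B ι : Type*} [Finite ι] {p : ι → List B → Prop}
    (h : ∀ i, IsRegularSet {u | p i u}) : IsRegularSet {u | ∃ i, p i u} := by
  have : {u | ∃ i, p i u} = ⋃ i ∈ (Set.univ : Set ι), {u | p i u} := by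
    ext; simp
  rw [this]
  exact isRegularSet_biUnion Set.finite_univ fun i _ => h i

theorem isRegularSet_setOf_exists_le {B : Type*} {p : ℕ → List B → Prop} (n : ℕ)
    (h : ∀ i ≤ n, IsRegularSet {u | p i u}) : IsRegularSet {u | ∃ i ≤ n, p i u} := by
  have : {u | ∃ i ≤ n, p i u} = ⋃ i ∈ Set.Iic n, {u | p i u} := by
    ext; simp
  rw [this]
  exact isRegularSet_biUnion (Set.finite_Iic n) fun i hi => h i hi

/-- The state `none` means that nothing has been read; afterwards the state keeps the verdict on the
first letter. -/
theorem isRegularSet_head? {B : Type*} (b : B) : IsRegularSet {u : List B | u.head? = some b} := by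
  classical
  have h := isRegularSet_foldl (fun (q : Option Prop) (a : B) => some (q.getD (a = b))) none
    {some True} Set.univ Set.finite_univ (Set.mem_univ _) (fun _ _ _ => Set.mem_univ _)
  have hf : ∀ (u : List B) (p : Prop),
      List.foldl (fun (q : Option Prop) (a : B) => some (q.getD (a = b))) (some p) u = some p := by
    intro u p
    induction u with
    | nil => rfl
    | cons a u ih => simpa using ih
  convert h using 1
  ext u
  cases u with
  | nil => simp
  | cons a u => simp [hf]

/-- A word followed by a power of a letter. -/
theorem isRegularSet_append_replicate {B : Type*} (v : List B) (b : B) :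
    IsRegularSet {u | ∃ k, u = v ++ List.replicate k b} := by
  classical
  -- The state is the part of `v` still to be read; `some []` loops on `b`, and `none` is a sink.
  -- Only suffixes of `v` occur, which gives finiteness.
  let δ : Option (List B) → B → Option (List B) := fun q a =>
    match q with
    | none => none
    | some [] => if a = b then some [] else none
    | some (c :: t) => if a = c then some t else none
  have hnone : ∀ u : List B, List.foldl δ none u = none := by
    intro u
    induction u with
    | nil => rfl
    | cons a u ih => simpa [δ] using ih
  have key : ∀ u t : List B,
      List.foldl δ (some t) u = some [] ↔ ∃ k, u = t ++ List.replicate k b := by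
    intro u
    induction u with
    | nil =>
      intro t
      simp only [List.foldl_nil, Option.some.injEq]
      constructor
      · rintro rfl
        exact ⟨0, rfl⟩
      · rintro ⟨k, hk⟩
        exact (List.append_eq_nil_iff.mp hk.symm).1
    | cons a u ih =>
      rintro (_ | ⟨c, t⟩)
      · by_cases hab : a = b
        · simp only [List.foldl_cons, δ, hab, if_true]
          rw [ih]
          constructor
          · rintro ⟨k, rfl⟩
            exact ⟨k + 1, by simp [List.replicate_succ]⟩
          · rintro ⟨k, hk⟩
            cases k with
            | zero => simp at hk
            | succ k => exact ⟨k, by simpa [List.replicate_succ] using hk⟩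
        · simp only [List.foldl_cons, δ, hab, if_false]
          rw [hnone]
          simp only [reduceCtorEq, false_iff, not_exists]
          intro k hk
          cases k with
          | zero => simp at hk
          | succ k => simp [List.replicate_succ, hab] at hk
      · by_cases hac : a = c
        · simp only [List.foldl_cons, δ, hac, if_true]
          rw [ih]
          simp
        · simp only [List.foldl_cons, δ, hac, if_false]
          rw [hnone]
          simp [hac]
  have h := isRegularSet_foldl δ (some v) {some []} (insert none (some '' {t | t <:+ v}))
    (by
      refine ((Set.Finite.subset (v.tails.finite_toSet) ?_).image _).insert _
      intro t ht
      simpa using ht)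
    (Or.inr ⟨v, List.suffix_rfl, rfl⟩)
    (by
      rintro q (rfl | ⟨t, ht, rfl⟩) a
      · exact Or.inl rfl
      · cases t with
        | nil =>
          by_cases hab : a = b
          · exact Or.inr ⟨[], ht, by simp [δ, hab]⟩
          · exact Or.inl (by simp [δ, hab])
        | cons c t =>
          by_cases hac : a = c
          · exact Or.inr ⟨t, (List.suffix_cons c t).trans ht, by simp [δ, hac]⟩
          · exact Or.inl (by simp [δ, hac]))
  convert h using 1
  ext u
  exact (key u v).symm

end Regular

/-! ### Rational relations from regular languages of pairs -/

section Rational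

variable {S : Type*} {V : Type*} [DecidableEq S] [DecidableEq V]

/-- The transducer that reads the first components of the words of a regular language of pairs and
writes the trimmed second components. -/
def trimTransducer {σ : Type*} (M : DFA (Track S V × Track S V) σ) :
    Transducer (Track S V) (σ × Bool) where
  trans p a b r := ∃ c d : Track S V, a = some c ∧ r.1 = M.step p.1 (c, d) ∧
    if p.2 = true ∧ d.1 = d.2 then b = none ∧ r.2 = true else b = some d ∧ r.2 = false
  initial := {(M.start, true)}
  final := {p | p.1 ∈ M.accept}

/-- The Boolean flag is `true` as long as everything has been trimmed; the first letter that is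
written turns it off for good. Acceptance ignores the flag, so its final value is hidden by the
existential quantifier. -/
theorem trimTransducer_run_iff {σ : Type*} (M : DFA (Track S V × Track S V) σ)
    (p : σ × Bool) (w w' : List (Track S V)) (q : σ) :
    (∃ b, (trimTransducer M).Run p w w' (q, b)) ↔
      ∃ u : List (Track S V × Track S V), u.map Prod.fst = w ∧
        w' = (if p.2 = true then trimWord (u.map Prod.snd) else u.map Prod.snd) ∧
        M.evalFrom p.1 u = q := by
  constructor
  · rintro ⟨b, h⟩
    generalize hr : (q, b) = r at h
    induction h with
    | nil p => subst hr; exact ⟨[], by simp [trimWord]⟩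
    | @cons p r s a a' w w' htr _ ih =>
      obtain ⟨u, rfl, rfl, hu⟩ := ih hr
      obtain ⟨c, d, rfl, h1, h2⟩ := htr
      refine ⟨(c, d) :: u, by simp, ?_, by rw [DFA.evalFrom_cons, ← h1, hu]⟩
      obtain ⟨p1, p2⟩ := p
      obtain ⟨r1, r2⟩ := r
      by_cases hd : d.1 = d.2
      · cases p2 <;> simp_all [trimWord]
      · cases p2 <;> simp_all [trimWord]
  · rintro ⟨u, rfl, rfl, rfl⟩
    induction u generalizing p with
    | nil => exact ⟨p.2, by simpa [trimWord] using Transducer.Run.nil p⟩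
    | cons a u ih =>
      obtain ⟨c, d⟩ := a
      obtain ⟨p1, p2⟩ := p
      by_cases hd : p2 = true ∧ d.1 = d.2
      · obtain ⟨b, hb⟩ := ih (M.step p1 (c, d), true)
        have htr : (trimTransducer M).trans (p1, p2) (some c) none (M.step p1 (c, d), true) :=
          ⟨c, d, rfl, rfl, by simp [hd]⟩
        refine ⟨b, ?_⟩
        simpa [trimWord, List.dropWhile_cons, hd] using Transducer.Run.cons htr hb
      · obtain ⟨b, hb⟩ := ih (M.step p1 (c, d), false)
        have htr : (trimTransducer M).trans (p1, p2) (some c) (some d) (M.step p1 (c, d), false) :=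
          ⟨c, d, rfl, rfl, by simp [hd]⟩
        refine ⟨b, ?_⟩
        have := Transducer.Run.cons htr hb
        by_cases hp : p2 = true
        · have hd' : d.1 ≠ d.2 := fun h => hd ⟨hp, h⟩
          simpa [trimWord, List.dropWhile_cons, hp, hd'] using this
        · simpa [trimWord, hp] using this

/-- Equal lengths allow a related pair to be zipped into one word of pairs, on which the automaton
runs. Trimming is built into the same machine, so no composition of rational relations is needed. -/
theorem isRational_trimWord {R : List (Track S V) → List (Track S V) → Prop}
    (hlen : ∀ w z, R w z → w.length = z.length)
    (hR : IsRegularSet {u : List (Track S V × Track S V) | R (u.map Prod.fst) (u.map Prod.snd)}) :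
    IsRational fun w w' => ∃ z, R w z ∧ w' = trimWord z := by
  obtain ⟨σ, hσ, M, hM⟩ := hR
  have hacc : ∀ u, M.evalFrom M.start u ∈ M.accept ↔ R (u.map Prod.fst) (u.map Prod.snd) := by
    intro u
    exact iff_of_eq (congrArg (fun L : Language _ => u ∈ L) hM)
  refine ⟨σ × Bool, inferInstance, trimTransducer M, fun w w' => ?_⟩
  constructor
  · rintro ⟨z, hz, rfl⟩
    have hl := hlen _ _ hz
    have hf : (w.zip z).map Prod.fst = w := List.map_fst_zip hl.le
    have hs : (w.zip z).map Prod.snd = z := List.map_snd_zip hl.ge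
    obtain ⟨b, hb⟩ := (trimTransducer_run_iff M (M.start, true) w (trimWord z)
      (M.evalFrom M.start (w.zip z))).mpr ⟨w.zip z, hf, by simp [hs], rfl⟩
    refine ⟨_, rfl, _, ?_, hb⟩
    change M.evalFrom M.start (w.zip z) ∈ M.accept
    rw [hacc, hf, hs]
    exact hz
  · rintro ⟨_, rfl, ⟨q, b⟩, hq, hrun⟩
    obtain ⟨u, rfl, rfl, rfl⟩ := (trimTransducer_run_iff M (M.start, true) w w' q).mp ⟨b, hrun⟩
    exact ⟨u.map Prod.snd, (hacc u).mp hq, by simp⟩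

end Rational

/-! ### Functional description of the substitutions on tracks -/

section Positions

variable {A : Type*} [DecidableEq A]

/-- The number of occurrences of a letter in a word. -/
def occ (a : A) (w : List A) : ℕ := w.countP fun s => decide (s = a)

@[simp]
theorem occ_nil (a : A) : occ a [] = 0 := rfl

@[simp]
theorem occ_cons (a s : A) (w : List A) :
    occ a (s :: w) = (if s = a then 1 else 0) + occ a w := by
  by_cases h : s = a <;> simp [occ, h, Nat.add_comm]

@[simp]
theorem occ_append (a : A) (w w' : List A) : occ a (w ++ w') = occ a w + occ a w' :=
  List.countP_append

theorem occ_replicate_of_ne {a b : A} (h : b ≠ a) (n : ℕ) : occ a (List.replicate n b) = 0 := by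
  simp [occ, h]

theorem occ_le_length (a : A) (w : List A) : occ a w ≤ w.length := List.countP_le_length

theorem _root_.List.Sublist.occ_le {w w' : List A} (h : w.Sublist w') (a : A) :
    occ a w ≤ occ a w' := h.countP_le

theorem card_filter_range_getElem? (a : A) (w : List A) (j : ℕ) :
    ((Finset.range j).filter fun m => w[m]? = some a).card = occ a (w.take j) := by
  induction j with
  | zero => simp
  | succ j ih =>
    rw [Finset.range_add_one, Finset.filter_insert, List.take_add_one, occ_append, ← ih]
    cases h : w[j]? with
    | none => simp
    | some b =>
      by_cases hb : b = a
      · subst hb; simp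
      · simp [hb]

theorem count_take_le (a : A) (w : List A) (j : ℕ) : occ a (w.take j) ≤ j :=
  (occ_le_length _ _).trans (by simp)

/-- A letter that survives the filter lands at its old position minus the number of deleted letters
before it. Only a prefix is determined; the padding at the end of `z` is a separate condition. -/
theorem filter_isPrefix_iff (a : A) (w z : List A) :
    (∀ j s, w[j]? = some s → s ≠ a → z[j - occ a (w.take j)]? = some s) ↔
      w.filter (fun s => decide (s ≠ a)) <+: z := by
  induction w generalizing z with
  | nil => simp
  | cons s w ih =>
    by_cases hs : s = a
    · subst hs
      simp only [ne_eq, not_true_eq_false, decide_false, Bool.false_eq_true,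
        not_false_eq_true, List.filter_cons_of_neg]
      rw [← ih]
      constructor
      · intro h j t ht hts
        simpa [Nat.add_comm 1] using h (j + 1) t (by simpa using ht) hts
      · rintro h (_ | j) t ht hts
        · simp at ht
          exact absurd ht.symm hts
        · simpa [Nat.add_comm 1] using h j t (by simpa using ht) hts
    · have hcount : ∀ j, occ a ((s :: w).take (j + 1)) = occ a (w.take j) := by
        intro j; simp [hs]
      have hsub : ∀ j, j + 1 - occ a (w.take j) = j - occ a (w.take j) + 1 := by
        intro j
        have := count_take_le a w j
        omega
      rw [List.filter_cons_of_pos (by simpa using hs)]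
      cases z with
      | nil =>
        simp only [List.prefix_nil, reduceCtorEq, iff_false]
        intro h
        simpa using h 0 s (by simp) hs
      | cons t z =>
        rw [List.cons_prefix_cons, ← ih]
        constructor
        · intro h
          have h0 := h 0 s (by simp) hs
          simp only [List.take_zero, occ_nil, Nat.sub_zero, List.getElem?_cons_zero,
            Option.some.injEq] at h0
          refine ⟨h0.symm, fun j r hr hra => ?_⟩
          have := h (j + 1) r (by simpa using hr) hra
          rwa [hcount, hsub, List.getElem?_cons_succ] at this
        · rintro ⟨rfl, h⟩ (_ | j) r hr hra
          · simpa using hr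
          · rw [hcount, hsub, List.getElem?_cons_succ]
            exact h j r (by simpa using hr) hra

/-- The block `[b, a]` of an occurrence of `a` starts at its old position plus the number of earlier
occurrences. For the moved `a` itself its own occurrence counts too, hence `take j` for `b` and
`take (j + 1)` for the old letters. -/
theorem flatMap_isPrefix_iff (a b : A) (w z : List A) :
    ((∀ j, w[j]? = some a → z[j + occ a (w.take j)]? = some b) ∧
      ∀ j s, w[j]? = some s → z[j + occ a (w.take (j + 1))]? = some s) ↔
      (w.flatMap fun s => if s = a then [b, a] else [s]) <+: z := by
  induction w generalizing z with
  | nil => simp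
  | cons s w ih =>
    by_cases hs : s = a
    · subst hs
      have hcount : ∀ j, occ s ((s :: w).take (j + 1)) = occ s (w.take j) + 1 := by
        intro j; simp [Nat.add_comm 1]
      have hadd : ∀ j m : ℕ, j + 1 + (m + 1) = j + m + 1 + 1 := by omega
      simp only [List.flatMap_cons, if_true, List.cons_append, List.nil_append]
      rcases z with _ | ⟨t, _ | ⟨t', z⟩⟩
      · simp only [List.prefix_nil, reduceCtorEq, iff_false]
        rintro ⟨h, -⟩
        simpa using h 0 (by simp)
      · simp only [List.cons_prefix_cons, List.prefix_nil, reduceCtorEq, and_false, iff_false]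
        rintro ⟨-, h⟩
        simpa using h 0 s (by simp)
      · rw [List.cons_prefix_cons, List.cons_prefix_cons, ← ih]
        constructor
        · rintro ⟨h1, h2⟩
          have e1 := h1 0 (by simp)
          have e2 := h2 0 s (by simp)
          simp only [List.take_zero, occ_nil, Nat.add_zero, List.getElem?_cons_zero,
            Option.some.injEq] at e1
          simp only [Nat.zero_add, hcount, List.take_zero, occ_nil,
            List.getElem?_cons_succ, List.getElem?_cons_zero, Option.some.injEq] at e2
          refine ⟨e1.symm, e2.symm, fun j hj => ?_, fun j r hr => ?_⟩
          · have := h1 (j + 1) (by simpa using hj)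
            rwa [hcount, hadd, List.getElem?_cons_succ, List.getElem?_cons_succ] at this
          · have := h2 (j + 1) r (by simpa using hr)
            rwa [hcount, hadd, List.getElem?_cons_succ, List.getElem?_cons_succ] at this
        · rintro ⟨rfl, rfl, h1, h2⟩
          constructor
          · rintro (_ | j) hj
            · simp
            · rw [hcount, hadd, List.getElem?_cons_succ, List.getElem?_cons_succ]
              exact h1 j (by simpa using hj)
          · rintro (_ | j) r hr
            · simpa using hr
            · rw [hcount, hadd, List.getElem?_cons_succ, List.getElem?_cons_succ]
              exact h2 j r (by simpa using hr)
    · have hcount : ∀ j, occ a ((s :: w).take (j + 1)) = occ a (w.take j) := by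
        intro j; simp [hs]
      have hadd : ∀ j m : ℕ, j + 1 + m = j + m + 1 := by omega
      simp only [List.flatMap_cons, if_neg hs, List.cons_append, List.nil_append]
      rcases z with _ | ⟨t, z⟩
      · simp only [List.prefix_nil, reduceCtorEq, iff_false]
        rintro ⟨-, h⟩
        simpa using h 0 s (by simp)
      · rw [List.cons_prefix_cons, ← ih]
        constructor
        · rintro ⟨h1, h2⟩
          have e2 := h2 0 s (by simp)
          simp only [Nat.zero_add, hcount, List.take_zero, occ_nil,
            List.getElem?_cons_zero, Option.some.injEq] at e2
          refine ⟨e2.symm, fun j hj => ?_, fun j r hr => ?_⟩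
          · have := h1 (j + 1) (by simpa using hj)
            rwa [hcount, hadd, List.getElem?_cons_succ] at this
          · have := h2 (j + 1) r (by simpa using hr)
            rwa [hcount, hadd, List.getElem?_cons_succ] at this
        · rintro ⟨rfl, h1, h2⟩
          constructor
          · rintro (_ | j) hj
            · exact absurd (by simpa using hj) hs
            · rw [hcount, hadd, List.getElem?_cons_succ]
              exact h1 j (by simpa using hj)
          · rintro (_ | j) r hr
            · simpa [hs] using hr
            · rw [hcount, hadd, List.getElem?_cons_succ]
              exact h2 j r (by simpa using hr)

theorem length_filter_ne_add_count (a : A) (w : List A) :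
    (w.filter fun s => decide (s ≠ a)).length + occ a w = w.length := by
  induction w with
  | nil => simp
  | cons s w ih => by_cases hs : s = a <;> simp_all <;> omega

theorem length_flatMap_ite (a b : A) (w : List A) :
    (w.flatMap fun s => if s = a then [b, a] else [s]).length = w.length + occ a w := by
  induction w with
  | nil => simp
  | cons s w ih =>
    rw [List.flatMap_cons, List.length_append, ih]
    by_cases hs : s = a
    · simp [hs]; omega
    · simp [hs]; omega

omit [DecidableEq A] in
theorem drop_eq_replicate_iff (a : A) (w : List A) (m : ℕ) :
    (∀ j < w.length, m ≤ j → w[j]? = some a) ↔ w.drop m = List.replicate (w.length - m) a := by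
  constructor
  · intro h
    refine List.ext_getElem? fun j => ?_
    rw [List.getElem?_drop, List.getElem?_replicate]
    split
    · exact h _ (by omega) (by omega)
    · exact List.getElem?_eq_none (by omega)
  · intro h j hj hm
    have := congrArg (fun l => l[j - m]?) h
    simp only [List.getElem?_drop, List.getElem?_replicate] at this
    rwa [if_pos (by omega), Nat.add_sub_cancel' hm] at this

end Positions

/-! ### The positional substitutions as `filter` and `flatMap`. -/

section Psi

variable {S : Type*} {V : Type*}

section

variable [DecidableEq S] [DecidableEq V]

/-- Since `i` enumerates the positions of `x` injectively, counting indices is counting letters.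
This is how the enumeration is eliminated from the substitutions. -/
theorem Occurrences.card_lt {n : ℕ} {x : V} {w : List (PadSym S V)} {i : Fin n → ℕ}
    (h : Occurrences x w i) (j : ℕ) :
    (Finset.univ.filter fun k => i k < j).card = occ (some (Sum.inr x)) (w.take j) := by
  rw [← card_filter_range_getElem?, ← Finset.card_image_of_injective _ h.1.injective]
  congr 1
  ext m
  simp only [Finset.mem_image, Finset.mem_filter, Finset.mem_univ, true_and, Finset.mem_range]
  constructor
  · rintro ⟨k, hk, rfl⟩
    exact ⟨hk, h.2.1 k⟩
  · rintro ⟨hm, hw⟩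
    obtain ⟨k, rfl⟩ := h.2.2 m hw
    exact ⟨k, hm, rfl⟩

theorem Occurrences.card_le {n : ℕ} {x : V} {w : List (PadSym S V)} {i : Fin n → ℕ}
    (h : Occurrences x w i) (j : ℕ) :
    (Finset.univ.filter fun k => i k ≤ j).card = occ (some (Sum.inr x)) (w.take (j + 1)) := by
  rw [← h.card_lt (j + 1)]
  simp

omit [DecidableEq S] [DecidableEq V] in
theorem Occurrences.lt_length {n : ℕ} {x : V} {w : List (PadSym S V)} {i : Fin n → ℕ}
    (h : Occurrences x w i) (k : Fin n) : i k < w.length :=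
  (List.getElem?_eq_some_iff.mp (h.2.1 k)).1

theorem Occurrences.count_eq {n : ℕ} {x : V} {w : List (PadSym S V)} {i : Fin n → ℕ}
    (h : Occurrences x w i) : occ (some (Sum.inr x)) w = n := by
  have := h.card_lt w.length
  rw [List.take_length] at this
  rw [← this, Finset.filter_true_of_mem fun k _ => h.lt_length k]
  simp

theorem Occurrences.count_take {n : ℕ} {x : V} {w : List (PadSym S V)} {i : Fin n → ℕ}
    (h : Occurrences x w i) (k : Fin n) : occ (some (Sum.inr x)) (w.take (i k)) = k := by
  rw [← h.card_lt]
  simp only [h.1.lt_iff_lt]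
  rw [Finset.filter_gt_eq_Iio, Fin.card_Iio]

theorem exists_occurrences (x : V) (w : List (PadSym S V)) :
    ∃ i : Fin (occ (some (Sum.inr x)) w) → ℕ, Occurrences x w i := by
  have hcard := card_filter_range_getElem? (some (Sum.inr x)) w w.length
  rw [List.take_length] at hcard
  set F := (Finset.range w.length).filter fun m => w[m]? = some (some (Sum.inr x)) with hF
  refine ⟨F.orderEmbOfFin hcard, (F.orderEmbOfFin hcard).strictMono, fun k => ?_, fun j hj => ?_⟩
  · exact (Finset.mem_filter.mp (F.orderEmbOfFin_mem hcard k)).2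
  · have hm : j ∈ F :=
      Finset.mem_filter.mpr ⟨Finset.mem_range.mpr (List.getElem?_eq_some_iff.mp hj).1, hj⟩
    have : j ∈ Set.range (F.orderEmbOfFin hcard) := by
      rw [Finset.range_orderEmbOfFin]; exact hm
    obtain ⟨k, hk⟩ := this
    exact ⟨k, hk.symm⟩

end

/-- The position conditions say that the filtered word is a prefix of `z`; equality of lengths
leaves room for exactly `n` more letters, and these are prescribed to be padding. -/
theorem psiErase_iff [DecidableEq S] [DecidableEq V] (n : ℕ) (x : V) (w z : List (PadSym S V)) :
    PsiErase n x w z ↔ occ (some (Sum.inr x)) w = n ∧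
      z = w.filter (fun s => decide (s ≠ some (Sum.inr x))) ++ List.replicate n pad := by
  have hlen := length_filter_ne_add_count (some (Sum.inr x)) w
  have main : ∀ {i : Fin n → ℕ}, Occurrences x w i →
      ((∀ j < w.length, (∀ k, j ≠ i k) →
          z[j - (Finset.univ.filter fun k => i k < j).card]? = w[j]?) ↔
        w.filter (fun s => decide (s ≠ some (Sum.inr x))) <+: z) := by
    intro i h
    rw [← filter_isPrefix_iff]
    simp only [h.card_lt]
    constructor
    · intro H j s hj hs
      rw [H j (List.getElem?_eq_some_iff.mp hj).1, hj]
      rintro k rfl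
      rw [h.2.1 k] at hj
      exact hs (Option.some.inj hj).symm
    · intro H j hj hk
      rw [List.getElem?_eq_getElem hj]
      refine H j _ (List.getElem?_eq_getElem hj) fun hx => ?_
      obtain ⟨k, hk'⟩ := h.2.2 j (by rw [List.getElem?_eq_getElem hj, hx])
      exact hk k hk'
  constructor
  · rintro ⟨hwz, i, h, h1, h2⟩
    have hn := h.count_eq
    refine ⟨hn, ?_⟩
    obtain ⟨t, rfl⟩ := (main h).mp h1
    rw [hwz] at h2
    rw [drop_eq_replicate_iff] at h2
    rw [List.length_append] at hwz h2
    rw [show (w.filter fun s => decide (s ≠ some (Sum.inr x))).length + t.length - n =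
      (w.filter fun s => decide (s ≠ some (Sum.inr x))).length by omega,
      List.drop_left, Nat.add_sub_cancel_left] at h2
    rw [h2, show t.length = n by omega]
  · rintro ⟨rfl, rfl⟩
    obtain ⟨i, h⟩ := exists_occurrences x w
    have hwz : w.length = (w.filter (fun s => decide (s ≠ some (Sum.inr x))) ++
        List.replicate (occ (some (Sum.inr x)) w) pad).length := by
      rw [List.length_append, List.length_replicate, hlen]
    refine ⟨hwz, i, h, (main h).mpr (List.prefix_append _ _), ?_⟩
    have hm : w.length - occ (some (Sum.inr x)) w =
        (w.filter (fun s => decide (s ≠ some (Sum.inr x)))).length := by omega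
    rw [hm]
    rw [hwz, drop_eq_replicate_iff, List.drop_left, List.length_append,
      List.length_replicate, Nat.add_sub_cancel_left]

/-- Writing `w` as `u` followed by `n` padding symbols, `z` is the substituted `u`. Padding is fixed
by the substitution, so appending it to both sides gives an equation that does not mention `u`. -/
theorem psiPrepend_iff [DecidableEq S] [DecidableEq V] (n : ℕ) (x : V) (α : Sym S V)
    (w z : List (PadSym S V)) :
    PsiPrepend n x α w z ↔ occ (some (Sum.inr x)) w = n ∧
      (w.flatMap fun s => if s = some (Sum.inr x) then [some α, some (Sum.inr x)] else [s]) =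
        z ++ List.replicate n pad := by
  have key : ∀ u : List (PadSym S V), w = u ++ List.replicate n pad →
      w.length = z.length → ∀ i : Fin n → ℕ, Occurrences x w i →
      (((∀ k : Fin n, z[i k + (k : ℕ)]? = some (some α)) ∧
        (∀ j, j + (Finset.univ.filter fun k => i k ≤ j).card < w.length →
          z[j + (Finset.univ.filter fun k => i k ≤ j).card]? = w[j]?)) ↔
      (u.flatMap fun s => if s = some (Sum.inr x) then [some α, some (Sum.inr x)] else [s]) =
        z) := by
    intro u hu hwz i h
    have hcu : occ (some (Sum.inr x)) u = n := by
      rw [← h.count_eq, hu, occ_append, occ_replicate_of_ne (by simp), Nat.add_zero]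
    have hlu : u.length + n = w.length := by rw [hu]; simp
    have hlf := length_flatMap_ite (some (Sum.inr x)) (some α) u
    have htake : ∀ j ≤ u.length, w.take j = u.take j := by
      intro j hj
      rw [hu, List.take_append_of_le_length hj]
    have hget : ∀ j < u.length, w[j]? = u[j]? := by
      intro j hj
      rw [hu, List.getElem?_append_left hj]
    have hgx : ∀ j, w[j]? = some (some (Sum.inr x)) → j < u.length := by
      intro j hj
      by_contra hlt
      rw [hu, List.getElem?_append_right (not_lt.mp hlt), List.getElem?_replicate] at hj
      split at hj <;> simp at hj
    have heq : (u.flatMap fun s => if s = some (Sum.inr x) then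
        [some α, some (Sum.inr x)] else [s]) = z ↔
        (u.flatMap fun s => if s = some (Sum.inr x) then
        [some α, some (Sum.inr x)] else [s]) <+: z :=
      ⟨fun h => h ▸ List.prefix_rfl, fun h => h.eq_of_length (by omega)⟩
    rw [heq, ← flatMap_isPrefix_iff]
    simp only [h.card_le]
    refine and_congr ⟨fun H j hj => ?_, fun H k => ?_⟩ ⟨fun H j s hj => ?_, fun H j hj => ?_⟩
    · have hju := (List.getElem?_eq_some_iff.mp hj).1
      obtain ⟨k, rfl⟩ := h.2.2 j (by rw [hget j hju, hj])
      rw [← htake _ hju.le, h.count_take]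
      exact H k
    · have hju := hgx _ (h.2.1 k)
      rw [← H (i k) (by rw [← hget _ hju, h.2.1 k]), ← htake _ hju.le, h.count_take]
    · have hju := (List.getElem?_eq_some_iff.mp hj).1
      have hc : occ (some (Sum.inr x)) (u.take (j + 1)) ≤ n := by
        rw [← hcu]
        exact (List.take_sublist _ _).occ_le _
      rw [← htake (j + 1) hju, H j (by rw [htake (j + 1) hju]; omega), hget j hju, hj]
    · have hju : j < u.length := by
        by_contra hlt
        have hcw : occ (some (Sum.inr x)) (w.take (j + 1)) = n := by
          rw [← h.card_le, Finset.filter_true_of_mem fun k _ => ?_]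
          · simp
          · have := hgx _ (h.2.1 k)
            omega
        omega
      rw [hget j hju, htake (j + 1) hju, List.getElem?_eq_getElem hju]
      exact H j _ (List.getElem?_eq_getElem hju)
  constructor
  · rintro ⟨hwz, i, h, h1, h2, h3⟩
    refine ⟨h.count_eq, ?_⟩
    have hn : n ≤ w.length := h.count_eq ▸ occ_le_length _ _
    rw [drop_eq_replicate_iff, Nat.sub_sub_self hn] at h3
    have hu : w = w.take (w.length - n) ++ List.replicate n pad := by
      rw [← h3, List.take_append_drop]
    have := (key _ hu hwz i h).mp ⟨h1, h2⟩
    rw [← this]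
    conv_lhs => rw [hu]
    rw [List.flatMap_append]
    congr 1
    generalize n = m
    induction m with
    | zero => rfl
    | succ m ih => simp [List.replicate_succ, ih]
  · rintro ⟨rfl, hz⟩
    obtain ⟨i, h⟩ := exists_occurrences x w
    have hlf := length_flatMap_ite (some (Sum.inr x)) (some α) w
    rw [hz, List.length_append, List.length_replicate] at hlf
    have hwz : w.length = z.length := by omega
    -- The image of `x` ends with `x`, not with padding. So each padding symbol at the end of the
    -- substituted word comes from one at the end of `w`.
    obtain ⟨u, hu⟩ : ∃ u, w = u ++ List.replicate (occ (some (Sum.inr x)) w) pad := by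
      have : ∀ (m : ℕ) (w z : List (PadSym S V)),
          (w.flatMap fun s => if s = some (Sum.inr x) then
            [some α, some (Sum.inr x)] else [s]) = z ++ List.replicate m pad →
          ∃ u, w = u ++ List.replicate m pad := by
        intro m
        induction m with
        | zero => exact fun w z _ => ⟨w, by simp⟩
        | succ m ih =>
          intro w z hw
          rcases List.eq_nil_or_concat' w with rfl | ⟨w, s, rfl⟩
          · simp at hw
          · rw [List.replicate_succ', ← List.append_assoc, List.flatMap_append] at hw
            by_cases hs : s = some (Sum.inr x)
            · rw [show (List.flatMap (fun s : PadSym S V => if s = some (Sum.inr x) then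
                [some α, some (Sum.inr x)] else [s]) [s]) =
                [some α] ++ [some (Sum.inr x)] by simp [hs], ← List.append_assoc] at hw
              simpa using (List.append_inj' hw rfl).2
            · rw [show (List.flatMap (fun s : PadSym S V => if s = some (Sum.inr x) then
                [some α, some (Sum.inr x)] else [s]) [s]) = [s] by simp [hs]] at hw
              obtain ⟨hw', hs'⟩ := List.append_inj' hw rfl
              obtain ⟨u, rfl⟩ := ih w z hw'
              refine ⟨u, ?_⟩
              rw [hs', List.replicate_succ', List.append_assoc]
      exact this _ w z hz
    have hflat : (u.flatMap fun s => if s = some (Sum.inr x) then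
        [some α, some (Sum.inr x)] else [s]) = z := by
      have hrep : ∀ m : ℕ, ((List.replicate m (pad : PadSym S V)).flatMap fun s =>
          if s = some (Sum.inr x) then [some α, some (Sum.inr x)] else [s]) =
          List.replicate m pad := by
        intro m
        induction m with
        | zero => rfl
        | succ m ih => simp [List.replicate_succ, ih]
      rw [hu, List.flatMap_append, hrep, ← hu] at hz
      exact List.append_cancel_right hz
    obtain ⟨h1, h2⟩ := (key u hu hwz i h).mpr hflat
    refine ⟨hwz, i, h, h1, h2, ?_⟩
    rw [drop_eq_replicate_iff, Nat.sub_sub_self (occ_le_length _ _)]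
    have hlu := congrArg List.length hu
    rw [List.length_append, List.length_replicate] at hlu
    rw [show w.length - occ (some (Sum.inr x)) w = u.length by omega]
    exact (congrArg (List.drop u.length) hu).trans List.drop_left

end Psi

/-! ### Regularity of the substitutions on tracks -/

section PsiRegular

variable {S : Type*} {V : Type*} [Finite S] [Finite V]

/-- A language of words over pairs is regular if it is recognized with a queue of at most `n`
letters that is empty at first and contains `n` copies of `b` in the end. -/
theorem isRegularSet_queue {A : Type*} [Finite A] (b : A) (n : ℕ)
    (next : List A → A × A → Option (List A)) (P : List A → List (A × A) → Prop)
    (hnil : ∀ q, P q [] ↔ q = List.replicate n b)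
    (hcons : ∀ q c u, q.length ≤ n →
      (P q (c :: u) ↔ ∃ q' ∈ next q c, q'.length ≤ n ∧ P q' u)) :
    IsRegularSet {u | P [] u} := by
  -- A queue that overflows leads to the sink `none`, so the reachable states form a finite set.
  let δ : Option (List A) → A × A → Option (List A) := fun q c =>
    q.bind fun q => (next q c).bind fun q' => if q'.length ≤ n then some q' else none
  have hnone : ∀ u, List.foldl δ none u = none := by
    intro u
    induction u with
    | nil => rfl
    | cons c u ih => simpa [δ] using ih
  have key : ∀ u q, q.length ≤ n →
      (List.foldl δ (some q) u = some (List.replicate n b) ↔ P q u) := by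
    intro u
    induction u with
    | nil => intro q _; simp [hnil]
    | cons c u ih =>
      intro q hq
      rw [hcons q c u hq, List.foldl_cons]
      cases hn : next q c with
      | none => simp [δ, hn, hnone]
      | some q' =>
        by_cases hq' : q'.length ≤ n
        · simp [δ, hn, hq', ← ih q' hq']
        · simp [δ, hn, hq', hnone]
  have h := isRegularSet_foldl δ (some []) {some (List.replicate n b)}
    (insert none (some '' {l : List A | l.length ≤ n}))
    (((List.finite_length_le A n).image _).insert _) (Or.inr ⟨[], by simp, rfl⟩)
    (by
      rintro q (rfl | ⟨q, hq, rfl⟩) c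
      · exact Or.inl rfl
      · cases hn : next q c with
        | none => exact Or.inl (by simp [δ, hn])
        | some q' =>
          by_cases hq' : q'.length ≤ n
          · exact Or.inr ⟨q', hq', by simp [δ, hn, hq']⟩
          · exact Or.inl (by simp [δ, hn, hq']))
  convert h using 1
  ext u
  exact (key u [] (by simp)).symm

/-- The output runs ahead of the input: the queue holds output letters waiting to be matched. Every
output letter is enqueued; an input `x` matches nothing, any other input letter must equal the front
and removes it. The queue length is thus the number of `x` read so far, and `n` paddings remain. -/
theorem isRegularSet_psiErase (n : ℕ) (x : V) :
    IsRegularSet {u : List (PadSym S V × PadSym S V) |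
      PsiErase n x (u.map Prod.fst) (u.map Prod.snd)} := by
  classical
  have h := isRegularSet_queue (pad : PadSym S V) n
    (fun q c => if c.1 = some (Sum.inr x) then some (q ++ [c.2]) else
      if (q ++ [c.2]).head? = some c.1 then some (q ++ [c.2]).tail else none)
    (fun q u => q.length + occ (some (Sum.inr x)) (u.map Prod.fst) = n ∧
      q ++ u.map Prod.snd = (u.map Prod.fst).filter (fun s => decide (s ≠ some (Sum.inr x))) ++
        List.replicate n pad)
    (by
      intro q
      simp only [List.map_nil, occ_nil, List.filter_nil, List.append_nil, List.nil_append]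
      exact ⟨fun h => h.2, fun h => ⟨by simp [h], h⟩⟩)
    (by
      rintro q ⟨s, t⟩ u hq
      by_cases hs : s = some (Sum.inr x)
      · subst hs
        simp only [List.map_cons, occ_cons, if_true, Option.mem_def,
          Option.some.injEq, exists_eq_left', List.length_append, List.length_singleton,
          List.append_assoc, List.singleton_append, ne_eq, not_true_eq_false, decide_false,
          Bool.false_eq_true, not_false_eq_true, List.filter_cons_of_neg]
        constructor
        · rintro ⟨h1, h2⟩
          exact ⟨by omega, by omega, h2⟩
        · rintro ⟨-, h1, h2⟩
          exact ⟨by omega, h2⟩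
      · have hfilter : ((s :: u.map Prod.fst).filter
            fun s => decide (s ≠ some (Sum.inr x))) = s :: (u.map Prod.fst).filter
            fun s => decide (s ≠ some (Sum.inr x)) :=
          List.filter_cons_of_pos (by simpa using hs)
        simp only [List.map_cons, hfilter, occ_cons, if_neg hs, Option.mem_def]
        rw [show q ++ t :: u.map Prod.snd = (q ++ [t]) ++ u.map Prod.snd by simp]
        have hl : (q ++ [t]).length = q.length + 1 := by simp
        obtain ⟨r, q', hq'⟩ : ∃ r q', q ++ [t] = r :: q' :=
          List.exists_cons_of_ne_nil (by simp)
        rw [hq'] at hl ⊢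
        rw [List.length_cons] at hl
        have hl' : q'.length = q.length := by omega
        by_cases hr : r = s
        · subst hr
          simp [hl', hq]
        · simp [hr])
  convert h using 1
  ext u
  simp only [Set.mem_ofPred_eq, psiErase_iff, List.length_nil, Nat.zero_add, List.nil_append]

/-- Here the output lags behind: the queue holds substituted input not yet written. Each step
enqueues the image of an input letter and dequeues one letter, which must be the output letter. The
queue grows by one at each `x`, and the final `n` paddings are never written. -/
theorem isRegularSet_psiPrepend (n : ℕ) (x : V) (α : Sym S V) :
    IsRegularSet {u : List (PadSym S V × PadSym S V) |
      PsiPrepend n x α (u.map Prod.fst) (u.map Prod.snd)} := by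
  classical
  have h := isRegularSet_queue (pad : PadSym S V) n
    (fun q c =>
      if (q ++ if c.1 = some (Sum.inr x) then [some α, some (Sum.inr x)] else [c.1]).head? =
        some c.2 then
      some (q ++ if c.1 = some (Sum.inr x) then [some α, some (Sum.inr x)] else [c.1]).tail
      else none)
    (fun q u => q.length + occ (some (Sum.inr x)) (u.map Prod.fst) = n ∧
      q ++ ((u.map Prod.fst).flatMap fun s =>
        if s = some (Sum.inr x) then [some α, some (Sum.inr x)] else [s]) =
      u.map Prod.snd ++ List.replicate n pad)
    (by
      intro q
      simp only [List.map_nil, occ_nil, List.flatMap_nil, List.append_nil, List.nil_append]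
      exact ⟨fun h => h.2, fun h => ⟨by simp [h], h⟩⟩)
    (by
      rintro q ⟨s, t⟩ u hq
      simp only [List.map_cons, List.flatMap_cons, Option.mem_def]
      rw [← List.append_assoc]
      generalize hv : (q ++ if s = some (Sum.inr x) then
        [some α, some (Sum.inr x)] else [s]) = v
      obtain ⟨r, q', rfl⟩ : ∃ r q', v = r :: q' := by
        apply List.exists_cons_of_ne_nil
        rw [← hv]
        split <;> simp
      have hl : q.length + occ (some (Sum.inr x)) (s :: u.map Prod.fst) =
          q'.length + occ (some (Sum.inr x)) (u.map Prod.fst) := by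
        have := congrArg List.length hv
        by_cases hs : s = some (Sum.inr x) <;> simp [hs] at this ⊢ <;> omega
      rw [hl]
      by_cases hr : r = t
      · subst hr
        simp
        intros
        omega
      · simp [hr])
  convert h using 1
  ext u
  simp only [Set.mem_ofPred_eq, psiPrepend_iff, List.length_nil, Nat.zero_add, List.nil_append]

end PsiRegular

/-! ### The transformers are rational -/

section Transformers

variable {S : Type*} {V : Type*} [Finite S] [Finite V] [DecidableEq S] [DecidableEq V]

theorem isRegularSet_map_head? {B C : Type*} (f : B → C) (c : C) :
    IsRegularSet {u : List B | (u.map f).head? = some c} :=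
  (isRegularSet_head? c).comap f

omit [Finite S] [Finite V] [DecidableEq S] [DecidableEq V] in
theorem isRegularSet_tracks {P : List (PadSym S V) → List (PadSym S V) → Prop}
    (h : IsRegularSet {u : List (PadSym S V × PadSym S V) |
      P (u.map Prod.fst) (u.map Prod.snd)}) (f : Track S V → PadSym S V) :
    IsRegularSet {u : List (Track S V × Track S V) |
      P ((u.map Prod.fst).map f) ((u.map Prod.snd).map f)} := by
  convert h.comap (fun c : Track S V × Track S V => (f c.1, f c.2)) using 1
  ext u
  simp [Function.comp_def]

omit [DecidableEq S] [DecidableEq V] in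
theorem isRegularSet_phiErase (n : ℕ) (x : V) :
    IsRegularSet {u : List (Track S V × Track S V) |
      PhiErase n x (u.map Prod.fst) (u.map Prod.snd)} := by
  refine IsRegularSet.inter (IsRegularSet.union ?_ ?_) ?_
  · exact (isRegularSet_map_head? Prod.fst _).comap Prod.fst
  · exact (isRegularSet_map_head? Prod.snd _).comap Prod.fst
  · refine isRegularSet_setOf_exists_le n fun m _ => isRegularSet_setOf_exists_le m fun k _ => ?_
    exact IsRegularSet.inter (isRegularSet_tracks (isRegularSet_psiErase k x) Prod.fst)
      (isRegularSet_tracks (isRegularSet_psiErase (m - k) x) Prod.snd)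

omit [DecidableEq S] [DecidableEq V] in
theorem isRegularSet_phiPrepend (n : ℕ) (x : V) (α : Sym S V) :
    IsRegularSet {u : List (Track S V × Track S V) |
      PhiPrepend n x α (u.map Prod.fst) (u.map Prod.snd)} := by
  refine IsRegularSet.inter (IsRegularSet.union (IsRegularSet.inter ?_ ?_)
    (IsRegularSet.inter ?_ ?_)) ?_
  · exact (isRegularSet_map_head? Prod.fst _).comap Prod.fst
  · exact (isRegularSet_map_head? Prod.snd _).comap Prod.fst
  · exact (isRegularSet_map_head? Prod.fst _).comap Prod.fst
  · exact (isRegularSet_map_head? Prod.snd _).comap Prod.fst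
  · refine isRegularSet_setOf_exists_le n fun m _ => isRegularSet_setOf_exists_le m fun k _ => ?_
    exact IsRegularSet.inter (isRegularSet_tracks (isRegularSet_psiPrepend k x α) Prod.fst)
      (isRegularSet_tracks (isRegularSet_psiPrepend (m - k) x α) Prod.snd)

/-- The union over the variables is taken on regular languages of pairs, before trimming, so that a
single transducer serves all of them. -/
theorem isRational_exists_tErase (n : ℕ) :
    IsRational fun w w' : List (Track S V) => ∃ x : V, TErase n x w w' := by
  convert isRational_trimWord (S := S) (V := V) (R := fun w z => ∃ x : V, PhiErase n x w z)
    ?_ ?_ using 4 with w w'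
  · simp only [TErase]
    exact ⟨fun ⟨x, z, h, e⟩ => ⟨z, ⟨x, h⟩, e⟩, fun ⟨z, ⟨x, h⟩, e⟩ => ⟨x, z, h, e⟩⟩
  · rintro w z ⟨x, -, m, -, k, -, h, -⟩
    simpa using h.1
  · exact isRegularSet_setOf_exists fun x => isRegularSet_phiErase n x

theorem isRational_exists_tPrepend (n : ℕ) :
    IsRational fun w w' : List (Track S V) => ∃ (x : V) (α : Sym S V), TPrepend n x α w w' := by
  convert isRational_trimWord (S := S) (V := V)
    (R := fun w z => ∃ (x : V) (α : Sym S V), PhiPrepend n x α w z) ?_ ?_ using 4 with w w'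
  · simp only [TPrepend]
    exact ⟨fun ⟨x, α, z, h, e⟩ => ⟨z, ⟨x, α, h⟩, e⟩, fun ⟨z, ⟨x, α, h⟩, e⟩ => ⟨x, α, z, h, e⟩⟩
  · rintro w z ⟨x, α, -, m, -, k, -, h, -⟩
    simpa using h.1
  · exact isRegularSet_setOf_exists fun x => isRegularSet_setOf_exists fun α =>
      isRegularSet_phiPrepend n x α

end Transformers

/-! ### Padded encodings -/

section Encodings

variable {S : Type*} {V : Type*}

/-- A word term filled up with padding to the length `N`. -/
def padTrack (t : List (Sym S V)) (N : ℕ) : List (PadSym S V) :=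
  t.map some ++ List.replicate (N - t.length) pad

/-- The length of the longer side of an equation. -/
def WordEquation.width (e : WordEquation S V) : ℕ := max e.lhs.length e.rhs.length

/-- The two sides of an equation on two tracks of length `N`. -/
def padEncode (e : WordEquation S V) (N : ℕ) : List (Track S V) :=
  (padTrack e.lhs N).zip (padTrack e.rhs N)

/-- The equation written on the two tracks of a word. -/
def decode (w : List (Track S V)) : WordEquation S V :=
  ⟨(w.map Prod.fst).reduceOption, (w.map Prod.snd).reduceOption⟩

theorem length_padTrack {t : List (Sym S V)} {N : ℕ} (h : t.length ≤ N) :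
    (padTrack t N).length = N := by
  simp [padTrack]
  omega

theorem map_fst_padEncode {e : WordEquation S V} {N : ℕ} (h : e.width ≤ N) :
    (padEncode e N).map Prod.fst = padTrack e.lhs N := by
  have h1 := le_trans (le_max_left _ _) h
  have h2 := le_trans (le_max_right _ _) h
  exact List.map_fst_zip (by rw [length_padTrack h1, length_padTrack h2])

theorem map_snd_padEncode {e : WordEquation S V} {N : ℕ} (h : e.width ≤ N) :
    (padEncode e N).map Prod.snd = padTrack e.rhs N := by
  have h1 := le_trans (le_max_left _ _) h
  have h2 := le_trans (le_max_right _ _) h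
  exact List.map_snd_zip (by rw [length_padTrack h1, length_padTrack h2])

theorem eq_padEncode_iff {e : WordEquation S V} {N : ℕ} (h : e.width ≤ N)
    (w : List (Track S V)) :
    w = padEncode e N ↔ w.map Prod.fst = padTrack e.lhs N ∧ w.map Prod.snd = padTrack e.rhs N := by
  constructor
  · rintro rfl
    exact ⟨map_fst_padEncode h, map_snd_padEncode h⟩
  · rintro ⟨h1, h2⟩
    rw [padEncode, ← h1, ← h2, List.zip_map', List.map_id']

theorem map_fst_eqEncode (l r : List (Sym S V)) :
    (eqEncode ⟨l, r⟩).map Prod.fst = padTrack l (max l.length r.length) := by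
  induction l generalizing r with
  | nil => simp [eqEncode, padTrack, Function.comp_def]
  | cons a l ih =>
    cases r with
    | nil => simp [eqEncode, padTrack, Function.comp_def]
    | cons b r =>
      have := ih r
      simp only [eqEncode, padTrack] at this ⊢
      simp [this]

theorem map_snd_eqEncode (l r : List (Sym S V)) :
    (eqEncode ⟨l, r⟩).map Prod.snd = padTrack r (max l.length r.length) := by
  induction l generalizing r with
  | nil => simp [eqEncode, padTrack, Function.comp_def]
  | cons a l ih =>
    cases r with
    | nil => simp [eqEncode, padTrack, Function.comp_def, List.replicate_succ]
    | cons b r =>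
      have := ih r
      simp only [eqEncode, padTrack] at this ⊢
      simp [this]

theorem padTrack_append_replicate {t : List (Sym S V)} {N : ℕ} (h : t.length ≤ N) (k : ℕ) :
    padTrack t N ++ List.replicate k pad = padTrack t (N + k) := by
  rw [padTrack, padTrack, List.append_assoc, List.replicate_append_replicate]
  congr 2
  omega

theorem eqEncode_append_replicate (e : WordEquation S V) (k : ℕ) :
    eqEncode e ++ List.replicate k pad2 = padEncode e (e.width + k) := by
  rw [eq_padEncode_iff (by omega)]
  rw [List.map_append, List.map_append, List.map_replicate, List.map_replicate]
  obtain ⟨l, r⟩ := e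
  rw [map_fst_eqEncode, map_snd_eqEncode]
  exact ⟨padTrack_append_replicate (le_max_left _ _) k,
    padTrack_append_replicate (le_max_right _ _) k⟩

theorem padEncode_append_replicate {e : WordEquation S V} {N : ℕ} (h : e.width ≤ N) (k : ℕ) :
    padEncode e N ++ List.replicate k pad2 = padEncode e (N + k) := by
  obtain ⟨m, rfl⟩ := Nat.exists_eq_add_of_le h
  rw [← eqEncode_append_replicate, List.append_assoc, List.replicate_append_replicate,
    eqEncode_append_replicate, Nat.add_assoc]

/-- The symbols of a term are never padding, so removing padding from the end of a padded track
cannot reach into the term. -/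
theorem append_replicate_eq_padTrack {z : List (PadSym S V)} {t : List (Sym S V)} {n N : ℕ}
    (ht : t.length ≤ N) (h : z ++ List.replicate n pad = padTrack t N) :
    t.length + n ≤ N ∧ z = padTrack t (N - n) := by
  induction n generalizing N with
  | zero => exact ⟨by omega, by simpa using h⟩
  | succ n ih =>
    rw [List.replicate_succ', ← List.append_assoc] at h
    obtain hN | hN := ht.eq_or_lt
    · exfalso
      have hmem : (pad : PadSym S V) ∈ padTrack t N := by rw [← h]; simp
      simp [padTrack, hN] at hmem
    · have h' : padTrack t N = padTrack t (N - 1) ++ [pad] := by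
        have := padTrack_append_replicate (t := t) (N := N - 1) (by omega) 1
        rw [Nat.sub_add_cancel (by omega)] at this
        exact this.symm
      rw [h'] at h
      obtain ⟨h1, h2⟩ := ih (by omega) (List.append_cancel_right h)
      exact ⟨by omega, by rw [h2]; congr 1; omega⟩

theorem append_replicate_eq_padEncode {e : WordEquation S V} {N k : ℕ} (h : e.width ≤ N)
    {w : List (Track S V)} (hw : w ++ List.replicate k pad2 = padEncode e N) :
    e.width ≤ N - k ∧ w = padEncode e (N - k) := by
  rw [eq_padEncode_iff h, List.map_append, List.map_append, List.map_replicate,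
    List.map_replicate] at hw
  obtain ⟨h1, h1'⟩ := append_replicate_eq_padTrack (le_trans (le_max_left _ _) h) hw.1
  obtain ⟨h2, h2'⟩ := append_replicate_eq_padTrack (le_trans (le_max_right _ _) h) hw.2
  have hk : e.width ≤ N - k := max_le (by omega) (by omega)
  exact ⟨hk, (eq_padEncode_iff hk w).mpr ⟨h1', h2'⟩⟩

theorem reduceOption_padTrack (t : List (Sym S V)) (N : ℕ) : (padTrack t N).reduceOption = t := by
  rw [padTrack, List.reduceOption_append, List.reduceOption_replicate_none, List.append_nil]
  simp [List.reduceOption]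

theorem decode_padEncode {e : WordEquation S V} {N : ℕ} (h : e.width ≤ N) :
    decode (padEncode e N) = e := by
  rw [decode, map_fst_padEncode h, map_snd_padEncode h, reduceOption_padTrack,
    reduceOption_padTrack]

theorem head?_padTrack (t : List (Sym S V)) (N : ℕ) (s : Sym S V) :
    (padTrack t N).head? = some (some s) ↔ t.head? = some s := by
  cases t with
  | nil =>
    simp only [padTrack, List.map_nil, List.nil_append, List.head?_replicate, List.head?_nil,
      reduceCtorEq, iff_false]
    split <;> simp
  | cons a t => simp [padTrack]

/-! ### Trimming, and the encodings of reduced equations. -/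

variable [DecidableEq S] [DecidableEq V]

theorem mem_encode_iff {e : WordEquation S V} {w : List (Track S V)} :
    w ∈ encode e ↔ ∃ N, e.width ≤ N ∧ w = trimWord (padEncode e N) := by
  constructor
  · rintro ⟨k, rfl⟩
    exact ⟨_, Nat.le_add_right _ k, by rw [eqEncode_append_replicate]⟩
  · rintro ⟨N, hN, rfl⟩
    obtain ⟨k, rfl⟩ := Nat.exists_eq_add_of_le hN
    exact ⟨k, by rw [eqEncode_append_replicate]⟩

theorem encode_nonempty (e : WordEquation S V) : (encode e).Nonempty := ⟨_, 0, rfl⟩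

/-- A common first symbol of the two sides becomes a letter `(β, β)` at the front of the encoding,
which `trimWord` removes anyway. -/
theorem encode_trim (e : WordEquation S V) : encode e.trim = encode e := by
  have key : ∀ (l r : List (Sym S V)) (k : ℕ),
      trimWord (eqEncode ⟨(trimPair l r).1, (trimPair l r).2⟩ ++ List.replicate k pad2) =
        trimWord (eqEncode ⟨l, r⟩ ++ List.replicate k pad2) := by
    intro l r k
    induction l generalizing r with
    | nil => simp [trimPair]
    | cons a l ih =>
      cases r with
      | nil => simp [trimPair]
      | cons b r =>
        by_cases hab : a = b
        · subst hab
          rw [trimPair, if_pos rfl, ih r]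
          simp [eqEncode, trimWord]
        · rw [trimPair, if_neg hab]
  ext w
  exact exists_congr fun k => by rw [WordEquation.trim, key]

theorem reduced_trim (e : WordEquation S V) : e.trim.Reduced := by
  have key : ∀ (l r : List (Sym S V)),
      WordEquation.Reduced ⟨(trimPair l r).1, (trimPair l r).2⟩ := by
    intro l r
    induction l generalizing r with
    | nil => intro a ha; simp [trimPair] at ha
    | cons a l ih =>
      cases r with
      | nil => intro a ha; simp [trimPair]
      | cons b r =>
        by_cases hab : a = b
        · rw [trimPair, if_pos hab]
          exact ih r
        · rw [trimPair, if_neg hab]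
          intro c hc hc'
          simp at hc hc'
          exact hab (hc.trans hc'.symm)
  exact key _ _

/-- The first letter of the encoding has different tracks: two distinct symbols, or a symbol against
padding. Only the trivial equation has to be excluded. -/
theorem trimWord_eqEncode_append {e : WordEquation S V} (he : e.Reduced)
    (hne : e ≠ ⟨[], []⟩) (k : ℕ) :
    trimWord (eqEncode e ++ List.replicate k pad2) = eqEncode e ++ List.replicate k pad2 := by
  obtain ⟨_ | ⟨a, l⟩, _ | ⟨b, r⟩⟩ := e
  · exact absurd rfl hne
  · simp [eqEncode, trimWord]
  · simp [eqEncode, trimWord]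
  · have hab : a ≠ b := by
      rintro rfl
      exact he a (by simp) (by simp)
    simp [eqEncode, trimWord, hab]

theorem encode_eq_of_reduced {e : WordEquation S V} (he : e.Reduced) (hne : e ≠ ⟨[], []⟩) :
    encode e = {w | ∃ k, w = eqEncode e ++ List.replicate k pad2} := by
  ext w
  exact exists_congr fun k => by rw [trimWord_eqEncode_append he hne]

/-- The exceptional case: `trimWord` also removes two-track padding, so no amount of it survives
here. -/
theorem encode_nil_nil : encode (⟨[], []⟩ : WordEquation S V) = {[]} := by
  have : ∀ k : ℕ, trimWord (List.replicate k (pad2 : Track S V)) = [] := by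
    intro k
    simp [trimWord]
  ext w
  simp [encode, eqEncode, this]

theorem mem_encode_of_reduced {e : WordEquation S V} (he : e.Reduced) {w : List (Track S V)}
    (hw : w ∈ encode e) : ∃ N, e.width ≤ N ∧ w = padEncode e N := by
  by_cases hne : e = ⟨[], []⟩
  · subst hne
    rw [encode_nil_nil] at hw
    exact ⟨0, by simp [WordEquation.width], by simpa [padEncode, padTrack] using hw⟩
  · rw [encode_eq_of_reduced he hne] at hw
    obtain ⟨k, rfl⟩ := hw
    exact ⟨_, Nat.le_add_right _ k, eqEncode_append_replicate e k⟩

theorem padEncode_mem_encode {e : WordEquation S V} (he : e.Reduced) (hne : e ≠ ⟨[], []⟩) {N : ℕ}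
    (hN : e.width ≤ N) : padEncode e N ∈ encode e := by
  rw [encode_eq_of_reduced he hne]
  obtain ⟨k, rfl⟩ := Nat.exists_eq_add_of_le hN
  exact ⟨k, (eqEncode_append_replicate e k).symm⟩

/-- Consequently the encodings of distinct reduced equations are disjoint, which lets word-level
inclusions and choices be read as statements about equations. -/
theorem decode_of_mem_encode {e : WordEquation S V} (he : e.Reduced) {w : List (Track S V)}
    (hw : w ∈ encode e) : decode w = e := by
  obtain ⟨N, hN, rfl⟩ := mem_encode_of_reduced he hw
  exact decode_padEncode hN

theorem isRegularSet_encode (e : WordEquation S V) : IsRegularSet (encode e) := by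
  rw [← encode_trim]
  by_cases hne : e.trim = ⟨[], []⟩
  · rw [hne, encode_nil_nil]
    convert (isRegularSet_append_replicate ([] : List (Track S V)) pad2).inter
      (isRegularSet_foldl (fun (_ : Bool) (_ : Track S V) => false) true {true} Set.univ
        Set.finite_univ (Set.mem_univ _) fun _ _ _ => Set.mem_univ _) using 1
    have hf : ∀ u : List (Track S V),
        List.foldl (fun (_ : Bool) (_ : Track S V) => false) false u = false := by
      intro u
      induction u with
      | nil => rfl
      | cons a u ih => exact ih
    ext u
    cases u with
    | nil => simp
    | cons a u => simp [hf]
  · rw [encode_eq_of_reduced (reduced_trim e) hne]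
    exact isRegularSet_append_replicate _ _

/-- Trimming either stops inside `w` and leaves the added padding intact, or consumes `w` and then
the padding as well. -/
theorem trimWord_append_replicate (w : List (Track S V)) (k : ℕ) :
    (trimWord w = [] ∧ trimWord (w ++ List.replicate k pad2) = []) ∨
      trimWord (w ++ List.replicate k pad2) = trimWord w ++ List.replicate k pad2 := by
  induction w with
  | nil => left; simp [trimWord]
  | cons p w ih =>
    by_cases hp : p.1 = p.2
    · simpa [trimWord, hp] using ih
    · right
      simp [trimWord, hp]

/-- The soundness of saturation: cutting off final padding leads from encodings to encodings of the
same equation. -/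
theorem mem_encode_of_append_replicate {e : WordEquation S V} {w : List (Track S V)} {k : ℕ}
    (h : w ++ List.replicate k pad2 ∈ encode e) : w ∈ encode e := by
  rw [← encode_trim] at h ⊢
  by_cases hne : e.trim = ⟨[], []⟩
  · rw [hne, encode_nil_nil] at h ⊢
    exact (List.append_eq_nil_iff.mp h).1
  · obtain ⟨N, hN, hw⟩ := mem_encode_of_reduced (reduced_trim e) h
    obtain ⟨hN', rfl⟩ := append_replicate_eq_padEncode hN hw
    exact padEncode_mem_encode (reduced_trim e) hne hN'

end Encodings

/-! ### The rules on equations and on encodings -/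

section Rules

variable {S : Type*} {V : Type*} [DecidableEq S] [DecidableEq V]

/-- The substitution of a Nielsen rule, applied to an equation. -/
def NielsenRule.subst : NielsenRule S V → WordEquation S V → WordEquation S V
  | .prepend x α => WordEquation.subst x [α, Sum.inr x]
  | .erase x => WordEquation.subst x []

omit [DecidableEq S] [DecidableEq V] in
/-- The condition on the first symbols under which a Nielsen rule is applicable. -/
def NielsenRule.Applicable : NielsenRule S V → WordEquation S V → Prop
  | .prepend x α, e => (e.lhs.head? = some (Sum.inr x) ∧ e.rhs.head? = some α) ∨
      (e.lhs.head? = some α ∧ e.rhs.head? = some (Sum.inr x))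
  | .erase x, e => e.lhs.head? = some (Sum.inr x) ∨ e.rhs.head? = some (Sum.inr x)

theorem nielsen_iff {ρ : NielsenRule S V} {e e' : WordEquation S V} :
    Nielsen ρ e e' ↔ ρ.Applicable e ∧ e' = (ρ.subst e).trim := by
  cases ρ <;> rfl

omit [DecidableEq S] [DecidableEq V] in
theorem NielsenRule.Applicable.ne_nil {ρ : NielsenRule S V} {e : WordEquation S V}
    (h : ρ.Applicable e) : e ≠ ⟨[], []⟩ := by
  rintro rfl
  cases ρ <;> simp [NielsenRule.Applicable] at h

/-- The number of occurrences of a symbol in an equation. -/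
def WordEquation.occ (s : Sym S V) (e : WordEquation S V) : ℕ :=
  WordEq.occ s e.lhs + WordEq.occ s e.rhs

theorem WordEquation.quadratic_iff {e : WordEquation S V} :
    e.Quadratic ↔ ∀ x, e.occ (Sum.inr x) ≤ 2 := by
  refine forall_congr' fun x => ?_
  rw [List.count_append, WordEquation.occ]
  -- `List.count` goes through the `BEq` instance of the sum type, whereas `occ` decides equality of
  -- symbols, so the two are compared symbol by symbol.
  have : ∀ t : List (Sym S V), t.count (Sum.inr x) = WordEq.occ (Sum.inr x) t := by
    intro t
    refine List.countP_congr fun s _ => ?_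
    rcases s with s | s
    · rw [decide_eq_true_iff]
      constructor
      · intro h; cases h
      · intro h; cases h
    · rw [decide_eq_true_iff]
      constructor
      · intro h
        exact congrArg Sum.inr (of_decide_eq_true h)
      · intro h
        exact decide_eq_true (Sum.inr.inj h)
  rw [this, this]

theorem occ_padTrack (x : V) (t : List (Sym S V)) (N : ℕ) :
    occ (some (Sum.inr x)) (padTrack t N) = occ (Sum.inr x) t := by
  rw [padTrack, occ_append, occ_replicate_of_ne (by simp), Nat.add_zero]
  induction t with
  | nil => rfl
  | cons s t ih => simp [ih]

theorem length_substTerm_nil (x : V) (t : List (Sym S V)) :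
    (substTerm x [] t).length + occ (Sum.inr x) t = t.length := by
  induction t with
  | nil => rfl
  | cons s t ih =>
    rw [substTerm, List.flatMap_cons, List.length_append, ← substTerm]
    by_cases hs : s = Sum.inr x
    · simp [hs]; omega
    · simp [hs]; omega

theorem length_substTerm_prepend (x : V) (α : Sym S V) (t : List (Sym S V)) :
    (substTerm x [α, Sum.inr x] t).length = t.length + occ (Sum.inr x) t :=
  length_flatMap_ite _ _ _

theorem psiErase_padTrack_iff {n N : ℕ} {x : V} {t : List (Sym S V)} {z : List (PadSym S V)}
    (ht : t.length ≤ N) : PsiErase n x (padTrack t N) z ↔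
      occ (Sum.inr x) t = n ∧ z = padTrack (substTerm x [] t) N := by
  rw [psiErase_iff, occ_padTrack]
  refine and_congr_right fun hn => ?_
  have hl := length_substTerm_nil x t
  rw [padTrack, List.filter_append, show (List.replicate (N - t.length) (pad : PadSym S V)).filter
    (fun s => decide (s ≠ some (Sum.inr x))) = List.replicate (N - t.length) pad by simp,
    List.append_assoc, List.replicate_append_replicate]
  have : (t.map some).filter (fun s => decide (s ≠ some (Sum.inr x))) =
      (substTerm x [] t).map some := by
    clear hl hn ht
    induction t with
    | nil => rfl
    | cons s t ih =>
      rw [substTerm, List.flatMap_cons, ← substTerm, List.map_append, ← ih]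
      by_cases hs : s = Sum.inr x
      · simp [hs]
      · simp [hs]
  rw [this, padTrack, show N - t.length + n = N - (substTerm x [] t).length by omega]

/-- The length condition is the requirement of room. It has no counterpart for erasing, where the
result always fits. -/
theorem psiPrepend_padTrack_iff {n N : ℕ} {x : V} {α : Sym S V} {t : List (Sym S V)}
    {z : List (PadSym S V)} (ht : t.length ≤ N) : PsiPrepend n x α (padTrack t N) z ↔
      occ (Sum.inr x) t = n ∧ (substTerm x [α, Sum.inr x] t).length ≤ N ∧
        z = padTrack (substTerm x [α, Sum.inr x] t) N := by
  rw [psiPrepend_iff, occ_padTrack]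
  refine and_congr_right fun hn => ?_
  have hl := length_substTerm_prepend x α t
  have hrep : ∀ m : ℕ, ((List.replicate m (pad : PadSym S V)).flatMap fun s =>
      if s = some (Sum.inr x) then [some α, some (Sum.inr x)] else [s]) =
      List.replicate m pad := by
    intro m
    induction m with
    | zero => rfl
    | succ m ih => simp [List.replicate_succ, ih]
  have hmap : ((t.map some).flatMap fun s =>
      if s = some (Sum.inr x) then [some α, some (Sum.inr x)] else [s]) =
      (substTerm x [α, Sum.inr x] t).map some := by
    clear hl hn ht
    induction t with
    | nil => rfl
    | cons s t ih =>
      rw [substTerm, List.flatMap_cons, ← substTerm, List.map_append, ← ih]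
      by_cases hs : s = Sum.inr x
      · simp [hs]
      · simp [hs]
  have hpad : ((padTrack t N).flatMap fun s =>
      if s = some (Sum.inr x) then [some α, some (Sum.inr x)] else [s]) =
      padTrack (substTerm x [α, Sum.inr x] t) (N + n) := by
    rw [padTrack, List.flatMap_append, hrep, hmap, padTrack]
    congr 2
    omega
  rw [hpad]
  constructor
  · intro h
    obtain ⟨h1, h2⟩ := append_replicate_eq_padTrack (by omega) h.symm
    rw [Nat.add_sub_cancel] at h2
    exact ⟨by omega, h2⟩
  · rintro ⟨h1, rfl⟩
    exact (padTrack_append_replicate h1 n).symm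

/-- The union of the transformers of all rules, on words with at most two occurrences of the
variable of the rule. -/
def ruleTrans (w w' : List (Track S V)) : Prop :=
  (∃ (y : V) (α : Sym S V), TPrepend 2 y α w w') ∨ ∃ y : V, TErase 2 y w w'

theorem width_subst_prepend_le_iff {x : V} {α : Sym S V} {e : WordEquation S V} {N : ℕ} :
    (NielsenRule.subst (.prepend x α) e).width ≤ N ↔
      (substTerm x [α, Sum.inr x] e.lhs).length ≤ N ∧
        (substTerm x [α, Sum.inr x] e.rhs).length ≤ N :=
  max_le_iff

theorem ruleTrans_padEncode_iff {e : WordEquation S V} (he : e.Quadratic) {N : ℕ}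
    (hN : e.width ≤ N) {w' : List (Track S V)} :
    ruleTrans (padEncode e N) w' ↔ ∃ ρ : NielsenRule S V, ρ.Applicable e ∧
      (ρ.subst e).width ≤ N ∧ w' = trimWord (padEncode (ρ.subst e) N) := by
  have hl : e.lhs.length ≤ N := le_trans (le_max_left _ _) hN
  have hr : e.rhs.length ≤ N := le_trans (le_max_right _ _) hN
  have hq := WordEquation.quadratic_iff.mp he
  simp only [ruleTrans, TPrepend, TErase, PhiPrepend, PhiErase, map_fst_padEncode hN,
    map_snd_padEncode hN, head?_padTrack, psiErase_padTrack_iff hl, psiErase_padTrack_iff hr,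
    psiPrepend_padTrack_iff hl, psiPrepend_padTrack_iff hr]
  constructor
  · rintro (⟨x, α, z, ⟨ha, m, -, k, -, ⟨-, h1, h2⟩, -, h3, h4⟩, rfl⟩ |
      ⟨x, z, ⟨ha, m, -, k, -, ⟨-, h2⟩, -, h4⟩, rfl⟩)
    · have hw := width_subst_prepend_le_iff.mpr ⟨h1, h3⟩
      exact ⟨.prepend x α, ha, hw, by rw [(eq_padEncode_iff hw z).mpr ⟨h2, h4⟩]⟩
    · have hw : (NielsenRule.subst (.erase x) e).width ≤ N := by
        have h1 := length_substTerm_nil x e.lhs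
        have h2 := length_substTerm_nil x e.rhs
        exact max_le (le_trans (Nat.le_of_add_right_le h1.le) hl)
          (le_trans (Nat.le_of_add_right_le h2.le) hr)
      exact ⟨.erase x, ha, hw, by rw [(eq_padEncode_iff hw z).mpr ⟨h2, h4⟩]⟩
  · rintro ⟨⟨x, α⟩ | ⟨x⟩, ha, hw, rfl⟩
    · obtain ⟨h1, h2⟩ := width_subst_prepend_le_iff.mp hw
      -- The bound 2 holds for the occurrences on both sides together since `e` is quadratic; the
      -- share of the left side is the `k` of the relation.
      exact Or.inl ⟨x, α, _, ⟨ha, _, hq x, occ (Sum.inr x) e.lhs, Nat.le_add_right _ _,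
        ⟨rfl, h1, map_fst_padEncode hw⟩,
        (Nat.add_sub_cancel_left _ _).symm, h2,
        map_snd_padEncode hw⟩, rfl⟩
    · exact Or.inr ⟨x, _, ⟨ha, _, hq x, occ (Sum.inr x) e.lhs, Nat.le_add_right _ _,
        ⟨rfl, map_fst_padEncode hw⟩,
        (Nat.add_sub_cancel_left _ _).symm,
        map_snd_padEncode hw⟩, rfl⟩

theorem ruleTrans_sound {e : WordEquation S V} (hr : e.Reduced) (he : e.Quadratic)
    {w w' : List (Track S V)} (hw : w ∈ encode e) (h : ruleTrans w w') :
    ∃ ρ e', Nielsen ρ e e' ∧ w' ∈ encode e' := by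
  obtain ⟨N, hN, rfl⟩ := mem_encode_of_reduced hr hw
  obtain ⟨ρ, ha, hwd, rfl⟩ := (ruleTrans_padEncode_iff he hN).mp h
  exact ⟨ρ, _, nielsen_iff.mpr ⟨ha, rfl⟩, by
    rw [encode_trim]; exact mem_encode_iff.mpr ⟨N, hwd, rfl⟩⟩

theorem mem_encode_of_mem_satur {e : WordEquation S V} (hr : e.Reduced) (he : e.Quadratic)
    {w w' : List (Track S V)} (hw : w ∈ encode e) (h : w' ∈ satur (image ruleTrans {w})) :
    ∃ ρ e', Nielsen ρ e e' ∧ w' ∈ encode e' := by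
  obtain ⟨k, _, rfl, h⟩ := h
  obtain ⟨ρ, e', hn, h⟩ := ruleTrans_sound hr he hw h
  exact ⟨ρ, e', hn, mem_encode_of_append_replicate h⟩

/-- Given an encoding of the result from tracks of length `N`, take the encoding of `e` of length `N
+ e.width`: long enough for `e` and for the substituted equation. The output then has `e.width`
surplus padding symbols, which saturation removes. -/
theorem exists_mem_satur {e e' : WordEquation S V} (hr : e.Reduced) (he : e.Quadratic)
    {ρ : NielsenRule S V} (hn : Nielsen ρ e e') {w' : List (Track S V)} (hw' : w' ∈ encode e') :
    ∃ w ∈ encode e, w' ∈ satur (image ruleTrans {w}) := by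
  obtain ⟨ha, rfl⟩ := nielsen_iff.mp hn
  rw [encode_trim, mem_encode_iff] at hw'
  obtain ⟨N, hN, rfl⟩ := hw'
  have hN' : (ρ.subst e).width ≤ N + e.width := hN.trans (Nat.le_add_right _ _)
  have hT := (ruleTrans_padEncode_iff he (Nat.le_add_left e.width N)).mpr ⟨ρ, ha, hN', rfl⟩
  refine ⟨_, padEncode_mem_encode hr ha.ne_nil (Nat.le_add_left e.width N), ?_⟩
  rw [← padEncode_append_replicate hN] at hT
  -- If trimming consumes everything, the surplus disappears with it, and saturation has to remove
  -- nothing.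
  obtain ⟨h1, h2⟩ | h := trimWord_append_replicate (padEncode (ρ.subst e) N) e.width
  · rw [h1]
    rw [h2] at hT
    exact ⟨0, _, rfl, hT⟩
  · rw [h] at hT
    exact ⟨_, _, rfl, hT⟩

/-! ### Sets of words and sets of equations. -/

/-- The encodings of the equations of a set. -/
def encodeSet (E : Set (WordEquation S V)) : Set (List (Track S V)) := ⋃ e ∈ E, encode e

/-- The equations that the Nielsen rules produce from the equations of a set. -/
def nielsenSucc (E : Set (WordEquation S V)) : Set (WordEquation S V) :=
  {e' | ∃ e ∈ E, ∃ ρ, Nielsen ρ e e'}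

theorem mem_encodeSet {E : Set (WordEquation S V)} {w : List (Track S V)} :
    w ∈ encodeSet E ↔ ∃ e ∈ E, w ∈ encode e := by
  simp [encodeSet]

theorem satur_image_encodeSet {E : Set (WordEquation S V)}
    (hE : ∀ e ∈ E, e.Reduced ∧ e.Quadratic) :
    satur (image ruleTrans (encodeSet E)) = encodeSet (nielsenSucc E) := by
  ext w'
  rw [mem_encodeSet]
  constructor
  · rintro ⟨k, w, hw, h⟩
    obtain ⟨e, he, hw⟩ := mem_encodeSet.mp hw
    obtain ⟨ρ, e', hn, h⟩ := mem_encode_of_mem_satur (hE e he).1 (hE e he).2 hw ⟨k, w, rfl, h⟩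
    exact ⟨e', ⟨e, he, ρ, hn⟩, h⟩
  · rintro ⟨e', ⟨e, he, ρ, hn⟩, h⟩
    obtain ⟨w, hw, k, _, rfl, h⟩ := exists_mem_satur (hE e he).1 (hE e he).2 hn h
    exact ⟨k, _, mem_encodeSet.mpr ⟨e, he, hw⟩, h⟩

/-- One encoding of `e` suffices to locate `e` in `F`, by decoding. Hence the loop test on languages
is a test on sets of equations. -/
theorem encodeSet_subset_iff {E F : Set (WordEquation S V)} (hE : ∀ e ∈ E, e.Reduced)
    (hF : ∀ e ∈ F, e.Reduced) : encodeSet E ⊆ encodeSet F ↔ E ⊆ F := by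
  constructor
  · intro h e he
    obtain ⟨w, hw⟩ := encode_nonempty e
    obtain ⟨f, hf, hwf⟩ := mem_encodeSet.mp (h (mem_encodeSet.mpr ⟨e, he, hw⟩))
    rwa [← decode_of_mem_encode (hE e he) hw, decode_of_mem_encode (hF f hf) hwf]
  · intro h w hw
    obtain ⟨e, he, hw⟩ := mem_encodeSet.mp hw
    exact mem_encodeSet.mpr ⟨e, h he, hw⟩

theorem isRegularSet_encodeSet {E : Set (WordEquation S V)} (hE : E.Finite) :
    IsRegularSet (encodeSet E) :=
  isRegularSet_biUnion hE fun e _ => isRegularSet_encode e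

/-- A word of padding decodes to the trivial equation, whose only encoding is the empty word.
Reaching the destination thus means reaching the trivial equation. -/
theorem replicate_mem_encodeSet_iff {E : Set (WordEquation S V)} (hE : ∀ e ∈ E, e.Reduced)
    {k : ℕ} : List.replicate k pad2 ∈ encodeSet E ↔ k = 0 ∧ ⟨[], []⟩ ∈ E := by
  constructor
  · intro h
    obtain ⟨e, he, hw⟩ := mem_encodeSet.mp h
    have : e = ⟨[], []⟩ := by
      rw [← decode_of_mem_encode (hE e he) hw]
      simp [decode, List.map_replicate, List.reduceOption_replicate_none]
    subst this
    rw [encode_nil_nil] at hw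
    exact ⟨by simpa using hw, he⟩
  · rintro ⟨rfl, h⟩
    exact mem_encodeSet.mpr ⟨_, h, by rw [encode_nil_nil]; rfl⟩

end Rules

/-! ### Nielsen transformations of quadratic equations -/

section Nielsen

variable {S : Type*} {V : Type*} [DecidableEq S] [DecidableEq V]

omit [DecidableEq S] [DecidableEq V] in
/-- The total length of the two sides of an equation. -/
def WordEquation.size (e : WordEquation S V) : ℕ := e.lhs.length + e.rhs.length

theorem trimPair_spec (l r : List (Sym S V)) :
    ∃ p, l = p ++ (trimPair l r).1 ∧ r = p ++ (trimPair l r).2 := by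
  induction l generalizing r with
  | nil => exact ⟨[], by simp [trimPair]⟩
  | cons a l ih =>
    cases r with
    | nil => exact ⟨[], by simp [trimPair]⟩
    | cons b r =>
      by_cases hab : a = b
      · obtain ⟨p, h1, h2⟩ := ih r
        refine ⟨a :: p, ?_⟩
        rw [trimPair, if_pos hab, List.cons_append, List.cons_append, ← h1, ← h2, hab]
        exact ⟨rfl, rfl⟩
      · exact ⟨[], by simp [trimPair, hab]⟩

theorem WordEquation.trim_spec (e : WordEquation S V) :
    ∃ p, e.lhs = p ++ e.trim.lhs ∧ e.rhs = p ++ e.trim.rhs :=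
  trimPair_spec e.lhs e.rhs

theorem WordEquation.occ_trim_le (e : WordEquation S V) (s : Sym S V) :
    e.trim.occ s ≤ e.occ s := by
  obtain ⟨p, h1, h2⟩ := e.trim_spec
  rw [WordEquation.occ, WordEquation.occ, h1, h2, occ_append, occ_append]
  omega

theorem WordEquation.size_trim_le (e : WordEquation S V) : e.trim.size ≤ e.size := by
  obtain ⟨p, h1, h2⟩ := e.trim_spec
  rw [WordEquation.size, WordEquation.size, h1, h2, List.length_append, List.length_append]
  omega

theorem WordEquation.Quadratic.trim {e : WordEquation S V} (he : e.Quadratic) :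
    e.trim.Quadratic :=
  WordEquation.quadratic_iff.mpr fun x =>
    (e.occ_trim_le _).trans (WordEquation.quadratic_iff.mp he x)

theorem occ_substTerm_prepend (x : V) (α s : Sym S V) (t : List (Sym S V)) :
    occ s (substTerm x [α, Sum.inr x] t) =
      occ s t + if α = s then occ (Sum.inr x) t else 0 := by
  induction t with
  | nil => simp [substTerm]
  | cons a t ih =>
    rw [substTerm, List.flatMap_cons, occ_append, ← substTerm, ih]
    by_cases ha : a = Sum.inr x
    · subst ha
      by_cases hs : α = s
      · simp [hs]; omega
      · simp [hs]
    · by_cases hs : α = s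
      · simp [hs, ha]
        omega
      · simp [hs, ha]

theorem occ_substTerm_nil (x : V) (s : Sym S V) (t : List (Sym S V)) :
    occ s (substTerm x [] t) = if s = Sum.inr x then 0 else occ s t := by
  induction t with
  | nil => simp [substTerm]
  | cons a t ih =>
    rw [substTerm, List.flatMap_cons, occ_append, ← substTerm, ih]
    by_cases ha : a = Sum.inr x
    · subst ha
      by_cases hs : s = Sum.inr x
      · simp [hs]
      · simp [hs, Ne.symm hs]
    · by_cases hs : s = Sum.inr x
      · simp [hs, ha]
      · simp [hs, ha]

omit [DecidableEq S] [DecidableEq V] in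
theorem NielsenRule.Applicable.ne_of_reduced {x : V} {α : Sym S V} {e : WordEquation S V}
    (hr : e.Reduced) (h : (NielsenRule.prepend x α).Applicable e) : α ≠ Sum.inr x := by
  rintro rfl
  rcases h with ⟨h1, h2⟩ | ⟨h1, h2⟩ <;> exact hr _ h1 h2

/-- After a rule `x ↪ αx`, the trimming removes the first symbol of both sides. -/
theorem exists_subst_prepend_eq_cons {x : V} {α : Sym S V} {e : WordEquation S V}
    (hr : e.Reduced) (h : (NielsenRule.prepend x α).Applicable e) :
    ∃ l r, e.subst x [α, Sum.inr x] = ⟨α :: l, α :: r⟩ := by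
  have hα := h.ne_of_reduced hr
  obtain ⟨_ | ⟨a, l⟩, _ | ⟨b, r⟩⟩ := e
  · simp [NielsenRule.Applicable] at h
  · simp [NielsenRule.Applicable] at h
  · simp [NielsenRule.Applicable] at h
  · rcases h with ⟨h1, h2⟩ | ⟨h1, h2⟩
    · simp only [List.head?_cons, Option.some.injEq] at h1 h2
      subst h1 h2
      exact ⟨_, _, by simp [WordEquation.subst, substTerm, hα]; exact ⟨rfl, rfl⟩⟩
    · simp only [List.head?_cons, Option.some.injEq] at h1 h2
      subst h1 h2
      exact ⟨_, _, by simp [WordEquation.subst, substTerm, hα]; exact ⟨rfl, rfl⟩⟩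

theorem occ_pos_of_head? {s : Sym S V} {t : List (Sym S V)}
    (h : t.head? = some s) : 0 < occ s t := by
  cases t with
  | nil => simp at h
  | cons a t =>
    simp only [List.head?_cons, Option.some.injEq] at h
    simp [h]

/-- At most two copies of `α` are inserted, while at least two, the new first symbols of both sides,
are trimmed. This is where quadraticity gives finiteness. -/
theorem Nielsen.prepend_bounds {x : V} {α : Sym S V} {e e' : WordEquation S V} (hr : e.Reduced)
    (he : e.Quadratic) (h : Nielsen (.prepend x α) e e') :
    (∀ s, e'.occ s ≤ e.occ s) ∧ e'.size ≤ e.size ∧ 0 < e.occ (Sum.inr x) := by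
  obtain ⟨ha, rfl⟩ := nielsen_iff.mp h
  obtain ⟨l, r, hlr⟩ := exists_subst_prepend_eq_cons hr ha
  have hx := WordEquation.quadratic_iff.mp he x
  have htrim : (WordEquation.mk (α :: l) (α :: r)).trim = (WordEquation.mk l r).trim := by
    simp [WordEquation.trim, trimPair]
  have hsub : NielsenRule.subst (.prepend x α) e = ⟨α :: l, α :: r⟩ := hlr
  rw [hsub, htrim]
  have hl : substTerm x [α, Sum.inr x] e.lhs = α :: l := congrArg WordEquation.lhs hlr
  have hr' : substTerm x [α, Sum.inr x] e.rhs = α :: r := congrArg WordEquation.rhs hlr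
  refine ⟨fun s => (WordEquation.occ_trim_le _ s).trans ?_,
    (WordEquation.size_trim_le _).trans ?_, ?_⟩
  · have h1 := occ_substTerm_prepend x α s e.lhs
    have h2 := occ_substTerm_prepend x α s e.rhs
    rw [hl, occ_cons] at h1
    rw [hr', occ_cons] at h2
    simp only [WordEquation.occ] at hx ⊢
    split_ifs at h1 h2 <;> omega
  · have h1 := length_substTerm_prepend x α e.lhs
    have h2 := length_substTerm_prepend x α e.rhs
    rw [hl, List.length_cons] at h1
    rw [hr', List.length_cons] at h2
    simp only [WordEquation.occ, WordEquation.size] at hx ⊢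
    omega
  · rcases ha with ha | ha
    · exact Nat.add_pos_left (occ_pos_of_head? ha.1) _
    · exact Nat.add_pos_right _ (occ_pos_of_head? ha.2)

theorem Nielsen.erase_bounds {x : V} {e e' : WordEquation S V} (h : Nielsen (.erase x) e e') :
    (∀ s, e'.occ s ≤ e.occ s) ∧ e'.size < e.size ∧ e'.occ (Sum.inr x) = 0 := by
  obtain ⟨ha, rfl⟩ := nielsen_iff.mp h
  have hocc : ∀ s, (NielsenRule.subst (.erase x) e).occ s =
      if s = Sum.inr x then 0 else e.occ s := by
    intro s
    simp only [NielsenRule.subst, WordEquation.subst, WordEquation.occ, occ_substTerm_nil]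
    split_ifs <;> rfl
  refine ⟨fun s => (WordEquation.occ_trim_le _ s).trans ?_,
    (WordEquation.size_trim_le _).trans_lt ?_, ?_⟩
  · rw [hocc]
    split_ifs <;> omega
  · have h1 := length_substTerm_nil x e.lhs
    have h2 := length_substTerm_nil x e.rhs
    simp only [NielsenRule.subst, WordEquation.subst, WordEquation.size]
    rcases ha with ha | ha
    · have := occ_pos_of_head? ha
      omega
    · have := occ_pos_of_head? ha
      omega
  · have := WordEquation.occ_trim_le (NielsenRule.subst (.erase x) e) (Sum.inr x)
    rw [hocc, if_pos rfl] at this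
    omega

theorem Nielsen.occ_le {ρ : NielsenRule S V} {e e' : WordEquation S V} (hr : e.Reduced)
    (he : e.Quadratic) (h : Nielsen ρ e e') (s : Sym S V) : e'.occ s ≤ e.occ s := by
  cases ρ with
  | prepend x α => exact (h.prepend_bounds hr he).1 s
  | erase x => exact h.erase_bounds.1 s

theorem Nielsen.size_le {ρ : NielsenRule S V} {e e' : WordEquation S V} (hr : e.Reduced)
    (he : e.Quadratic) (h : Nielsen ρ e e') : e'.size ≤ e.size := by
  cases ρ with
  | prepend x α => exact (h.prepend_bounds hr he).2.1
  | erase x => exact h.erase_bounds.2.1.le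

theorem Nielsen.reduced {ρ : NielsenRule S V} {e e' : WordEquation S V} (h : Nielsen ρ e e') :
    e'.Reduced := by
  obtain ⟨-, rfl⟩ := nielsen_iff.mp h
  exact reduced_trim _

theorem Nielsen.quadratic {ρ : NielsenRule S V} {e e' : WordEquation S V} (hr : e.Reduced)
    (he : e.Quadratic) (h : Nielsen ρ e e') : e'.Quadratic :=
  WordEquation.quadratic_iff.mpr fun x =>
    (h.occ_le hr he _).trans (WordEquation.quadratic_iff.mp he x)

/-! ### Models and Nielsen transformations -/

omit [DecidableEq S] [DecidableEq V] in
@[simp]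
theorem Assignment.eval_nil (I : Assignment S V) : I.eval [] = [] := rfl

omit [DecidableEq S] [DecidableEq V] in
@[simp]
theorem Assignment.eval_cons (I : Assignment S V) (s : Sym S V) (t : List (Sym S V)) :
    I.eval (s :: t) = I.evalSym s ++ I.eval t := rfl

omit [DecidableEq S] [DecidableEq V] in
@[simp]
theorem Assignment.eval_append (I : Assignment S V) (t t' : List (Sym S V)) :
    I.eval (t ++ t') = I.eval t ++ I.eval t' := List.flatMap_append

theorem isModel_trim_iff {e : WordEquation S V} {I : Assignment S V} :
    IsModel e.trim I ↔ IsModel e I := by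
  obtain ⟨p, h1, h2⟩ := e.trim_spec
  rw [IsModel, IsModel, h1, h2, Assignment.eval_append, Assignment.eval_append,
    List.append_cancel_left_eq]

theorem Assignment.eval_substTerm (I : Assignment S V) (x : V) (r t : List (Sym S V)) :
    I.eval (substTerm x r t) = Assignment.eval (Function.update I x (I.eval r)) t := by
  induction t with
  | nil => rfl
  | cons s t ih =>
    rw [substTerm, List.flatMap_cons, Assignment.eval_append, ← substTerm, ih,
      Assignment.eval_cons]
    congr 1
    rcases s with c | y
    · simp [Assignment.evalSym]
    · by_cases hy : y = x
      · subst hy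
        simp [Assignment.evalSym]
      · simp [Assignment.evalSym, hy]

theorem isModel_subst_iff {e : WordEquation S V} {I : Assignment S V} {x : V}
    {r : List (Sym S V)} :
    IsModel (e.subst x r) I ↔ IsModel e (Function.update I x (I.eval r)) := by
  rw [IsModel, IsModel, WordEquation.subst, Assignment.eval_substTerm, Assignment.eval_substTerm]

/-- `I` is a model of `e` that maps all variables without occurrences in `e` to `ε`. -/
def IsNarrowModel (e : WordEquation S V) (I : Assignment S V) : Prop :=
  IsModel e I ∧ ∀ y, e.occ (Sum.inr y) = 0 → I y = []

/-- One backward step of the extraction. Occurrences never increase along a rule, so a variable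
absent from `e` is absent from `e'` and has the value `ε` already; the variable updated by `x ↪ αx`
does occur in `e`. -/
theorem Nielsen.isNarrowModel {ρ : NielsenRule S V} {e e' : WordEquation S V} (hr : e.Reduced)
    (he : e.Quadratic) (h : Nielsen ρ e e') {I : Assignment S V} (hI : IsNarrowModel e' I) :
    IsNarrowModel e (extractUpdate I ρ) := by
  obtain ⟨hI, hI0⟩ := hI
  have hocc : ∀ y, e.occ (Sum.inr y) = 0 → I y = [] := fun y hy =>
    hI0 y (Nat.le_zero.mp (hy ▸ h.occ_le hr he _))
  cases ρ with
  | prepend x α =>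
    constructor
    · obtain ⟨-, rfl⟩ := nielsen_iff.mp h
      have := isModel_subst_iff.mp (isModel_trim_iff.mp hI)
      simpa [Assignment.evalSym, extractUpdate] using this
    · intro y hy
      have hyx : y ≠ x := by
        rintro rfl
        exact (h.prepend_bounds hr he).2.2.ne' hy
      rw [extractUpdate, Function.update_of_ne hyx]
      exact hocc y hy
  | erase x =>
    refine ⟨?_, hocc⟩
    -- The erased variable no longer occurs in `e'`, so its value is `ε`, and the unchanged
    -- assignment agrees with the substitution.
    have hx := hI0 x h.erase_bounds.2.2
    obtain ⟨-, rfl⟩ := nielsen_iff.mp h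
    have := isModel_subst_iff.mp (isModel_trim_iff.mp hI)
    rwa [Assignment.eval_nil, ← hx, Function.update_eq_self] at this

/-! ### Descent along a model. -/

theorem exists_nielsen_erase [Fintype V] {e : WordEquation S V} {J : Assignment S V}
    (hJ : IsModel e J) {x : V} (ha : (NielsenRule.erase x).Applicable e) (hx : J x = []) :
    ∃ ρ e' J', Nielsen ρ e e' ∧ IsModel e' J' ∧
      (∑ y, (J' y).length) + e'.size < (∑ y, (J y).length) + e.size := by
  have hn := nielsen_iff.mpr ⟨ha, rfl⟩
  refine ⟨_, _, J, hn, isModel_trim_iff.mpr (isModel_subst_iff.mpr ?_), ?_⟩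
  · rwa [Assignment.eval_nil, ← hx, Function.update_eq_self]
  · exact Nat.add_lt_add_left hn.erase_bounds.2.1 _

/-- The value of `x` loses the nonempty prefix `J.evalSym α`, and the size of the equation does not
grow, so the sum decreases. -/
theorem exists_nielsen_prepend [Fintype V] {e : WordEquation S V} (hr : e.Reduced)
    (he : e.Quadratic) {J : Assignment S V} (hJ : IsModel e J) {x : V} {α : Sym S V}
    (ha : (NielsenRule.prepend x α).Applicable e) {t : List S} (hx : J x = J.evalSym α ++ t)
    (hα : J.evalSym α ≠ []) :
    ∃ ρ e' J', Nielsen ρ e e' ∧ IsModel e' J' ∧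
      (∑ y, (J' y).length) + e'.size < (∑ y, (J y).length) + e.size := by
  have hn := nielsen_iff.mpr ⟨ha, rfl⟩
  have hαx := ha.ne_of_reduced hr
  refine ⟨_, _, Function.update J x t, hn, isModel_trim_iff.mpr (isModel_subst_iff.mpr ?_), ?_⟩
  · have : Assignment.evalSym (Function.update J x t) α = J.evalSym α := by
      rcases α with c | y
      · rfl
      · have hyx : y ≠ x := fun h => hαx (congrArg Sum.inr h)
        simp [Assignment.evalSym, hyx]
    have hx' : Assignment.evalSym (Function.update J x t) (Sum.inr x) = t := by
      simp [Assignment.evalSym]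
    simpa only [Assignment.eval_cons, Assignment.eval_nil, this, hx', List.append_nil, ← hx,
      Function.update_idem, Function.update_eq_self] using hJ
  · refine add_lt_add_of_lt_of_le ?_ (hn.prepend_bounds hr he).2.1
    refine Finset.sum_lt_sum (fun y _ => ?_) ⟨x, Finset.mem_univ _, ?_⟩
    · by_cases hy : y = x
      · subst hy
        simp [hx]
      · simp [hy]
    · simpa [hx] using List.length_pos_iff.mpr hα

omit [DecidableEq S] [DecidableEq V] in
-- If `b` is a variable, then it is the one to be rewritten. If `b` is a character, then the
-- nonempty prefix is all of it, so `a` is a variable with the same value, and the rule is `a ↪ ba`.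
theorem exists_prepend_of_prefix {J : Assignment S V} {a b : Sym S V} (hab : a ≠ b)
    (ha : J.evalSym a ≠ []) {t : List S} (h : J.evalSym b = J.evalSym a ++ t) :
    ∃ x α t', ((b = Sum.inr x ∧ α = a) ∨ (a = Sum.inr x ∧ α = b)) ∧
      J x = J.evalSym α ++ t' ∧ J.evalSym α ≠ [] := by
  rcases b with c | x
  · rcases a with d | y
    · simp [Assignment.evalSym] at h
      exact absurd (congrArg Sum.inl h.1.symm) hab
    · refine ⟨y, Sum.inl c, [], Or.inr ⟨rfl, rfl⟩, ?_, by simp [Assignment.evalSym]⟩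
      simp only [Assignment.evalSym] at h ha ⊢
      cases hy : J y with
      | nil => exact absurd hy ha
      | cons d l => simp [hy] at h; simp [h]
  · exact ⟨x, a, t, Or.inl ⟨rfl, rfl⟩, h, ha⟩

/-- A model of a nontrivial reduced quadratic equation determines a rule that leads to an equation
with a smaller model. -/
theorem exists_nielsen_of_isModel [Fintype V] {e : WordEquation S V} (hr : e.Reduced)
    (he : e.Quadratic) (hne : e ≠ ⟨[], []⟩) {J : Assignment S V} (hJ : IsModel e J) :
    ∃ ρ e' J', Nielsen ρ e e' ∧ IsModel e' J' ∧
      (∑ y, (J' y).length) + e'.size < (∑ y, (J y).length) + e.size := by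
  have hsym : ∀ {a : Sym S V}, J.evalSym a = [] → ∃ x, a = Sum.inr x ∧ J x = [] := by
    rintro (c | x) h
    · simp [Assignment.evalSym] at h
    · exact ⟨x, rfl, h⟩
  have hlhs : ∀ a ∈ e.lhs.head?, J.evalSym a = [] → ∃ ρ e' J', Nielsen ρ e e' ∧ IsModel e' J' ∧
      (∑ y, (J' y).length) + e'.size < (∑ y, (J y).length) + e.size := by
    intro a ha h
    obtain ⟨x, rfl, hx⟩ := hsym h
    exact exists_nielsen_erase hJ (Or.inl ha) hx
  have hrhs : ∀ a ∈ e.rhs.head?, J.evalSym a = [] → ∃ ρ e' J', Nielsen ρ e e' ∧ IsModel e' J' ∧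
      (∑ y, (J' y).length) + e'.size < (∑ y, (J y).length) + e.size := by
    intro a ha h
    obtain ⟨x, rfl, hx⟩ := hsym h
    exact exists_nielsen_erase hJ (Or.inr ha) hx
  have hJ' := hJ
  cases hl : e.lhs with
  | nil =>
    cases hrr : e.rhs with
    | nil => exact absurd (WordEquation.ext hl hrr) hne
    | cons b r =>
      rw [IsModel, hl, hrr, Assignment.eval_nil, Assignment.eval_cons] at hJ'
      exact hrhs b (by simp [hrr]) (List.append_eq_nil_iff.mp hJ'.symm).1
  | cons a l =>
    cases hrr : e.rhs with
    | nil =>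
      rw [IsModel, hl, hrr, Assignment.eval_nil, Assignment.eval_cons] at hJ'
      exact hlhs a (by simp [hl]) (List.append_eq_nil_iff.mp hJ').1
    | cons b r =>
      by_cases ha : J.evalSym a = []
      · exact hlhs a (by simp [hl]) ha
      by_cases hb : J.evalSym b = []
      · exact hrhs b (by simp [hrr]) hb
      have hab : a ≠ b := by
        rintro rfl
        exact hr a (by simp [hl]) (by simp [hrr])
      -- As both sides have the same value, one of the values of the first symbols is a prefix of
      -- the other.
      rw [IsModel, hl, hrr, Assignment.eval_cons, Assignment.eval_cons,
        List.append_eq_append_iff] at hJ'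
      have key : ∃ x α t', ((b = Sum.inr x ∧ α = a) ∨ (a = Sum.inr x ∧ α = b)) ∧
          J x = J.evalSym α ++ t' ∧ J.evalSym α ≠ [] := by
        rcases hJ' with ⟨t, h, -⟩ | ⟨t, h, -⟩
        · exact exists_prepend_of_prefix hab ha h
        · obtain ⟨x, α, t', h1, h2⟩ := exists_prepend_of_prefix hab.symm hb h
          exact ⟨x, α, t', h1.symm, h2⟩
      obtain ⟨x, α, t', h, hx, hα⟩ := key
      refine exists_nielsen_prepend hr he hJ (x := x) (α := α) ?_ hx hα
      rcases h with ⟨rfl, rfl⟩ | ⟨rfl, rfl⟩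
      · exact Or.inr ⟨by simp [hl], by simp [hrr]⟩
      · exact Or.inl ⟨by simp [hl], by simp [hrr]⟩

/-! ### The equations reachable in a given number of steps -/

/-- The equations that are obtained from `e` by trimming and `n` Nielsen transformations. -/
def reachEq (e : WordEquation S V) (n : ℕ) : Set (WordEquation S V) := nielsenSucc^[n] {e.trim}

theorem reachEq_succ (e : WordEquation S V) (n : ℕ) :
    reachEq e (n + 1) = nielsenSucc (reachEq e n) :=
  Function.iterate_succ_apply' _ _ _

theorem reachEq_bounds {e : WordEquation S V} (he : e.Quadratic) (n : ℕ) :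
    ∀ f ∈ reachEq e n, (f.Reduced ∧ f.Quadratic) ∧ f.size ≤ e.size := by
  induction n with
  | zero =>
    rintro f rfl
    exact ⟨⟨reduced_trim e, he.trim⟩, e.size_trim_le⟩
  | succ n ih =>
    intro f hf
    rw [reachEq_succ] at hf
    obtain ⟨g, hg, ρ, hn⟩ := hf
    obtain ⟨⟨h1, h2⟩, h3⟩ := ih g hg
    exact ⟨⟨hn.reduced, hn.quadratic h1 h2⟩, (hn.size_le h1 h2).trans h3⟩

omit [DecidableEq S] [DecidableEq V] in
theorem finite_setOf_size_le [Finite S] [Finite V] (n : ℕ) :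
    {e : WordEquation S V | e.size ≤ n}.Finite := by
  have h := List.finite_length_le (Sym S V) n
  refine ((h.prod h).image fun p => (⟨p.1, p.2⟩ : WordEquation S V)).subset ?_
  intro e he
  have he' : e.lhs.length + e.rhs.length ≤ n := he
  exact ⟨(e.lhs, e.rhs), ⟨(Nat.le_add_right _ _).trans he', (Nat.le_add_left _ _).trans he'⟩, rfl⟩

theorem exists_nil_mem_reachEq [Fintype V] {e : WordEquation S V} (he : e.Quadratic)
    {J : Assignment S V} (hJ : IsModel e J) : ∃ n, ⟨[], []⟩ ∈ reachEq e n := by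
  have key : ∀ (m n : ℕ) (f : WordEquation S V) (J : Assignment S V), f ∈ reachEq e n →
      IsModel f J → (∑ y, (J y).length) + f.size ≤ m → ∃ n, ⟨[], []⟩ ∈ reachEq e n := by
    intro m
    induction m with
    | zero =>
      intro n f J hf _ hm
      have hs : f.lhs.length + f.rhs.length = 0 := Nat.le_zero.mp ((Nat.le_add_left _ _).trans hm)
      have : f = ⟨[], []⟩ :=
        WordEquation.ext (List.length_eq_zero_iff.mp (by omega))
          (List.length_eq_zero_iff.mp (by omega))
      exact ⟨n, this ▸ hf⟩
    | succ m ih =>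
      intro n f J hf hJ hm
      by_cases hne : f = ⟨[], []⟩
      · exact ⟨n, hne ▸ hf⟩
      · obtain ⟨⟨hr, hq⟩, -⟩ := reachEq_bounds he n f hf
        obtain ⟨ρ, f', J', hn, hJ', hlt⟩ := exists_nielsen_of_isModel hr hq hne hJ
        exact ih (n + 1) f' J' (by rw [reachEq_succ]; exact ⟨f, hf, ρ, hn⟩) hJ' (by omega)
  exact key _ 0 e.trim J rfl (isModel_trim_iff.mpr hJ) le_rfl

/-- The equations that are reachable in less than `n` steps. -/
def processedEq (e : WordEquation S V) (n : ℕ) : Set (WordEquation S V) :=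
  ⋃ j ∈ Set.Iio n, reachEq e j

theorem mem_processedEq {e f : WordEquation S V} {n : ℕ} :
    f ∈ processedEq e n ↔ ∃ j < n, f ∈ reachEq e j := by
  simp [processedEq]

theorem processedEq_succ (e : WordEquation S V) (n : ℕ) :
    processedEq e (n + 1) = processedEq e n ∪ reachEq e n := by
  ext f
  simp only [Set.mem_union, mem_processedEq, Nat.lt_succ_iff_lt_or_eq]
  constructor
  · rintro ⟨j, hj | rfl, hf⟩
    · exact Or.inl ⟨j, hj, hf⟩
    · exact Or.inr hf
  · rintro (⟨j, hj, hf⟩ | hf)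
    · exact ⟨j, Or.inl hj, hf⟩
    · exact ⟨n, Or.inr rfl, hf⟩

theorem processedEq_bounds {e : WordEquation S V} (he : e.Quadratic) (n : ℕ) :
    ∀ f ∈ processedEq e n, (f.Reduced ∧ f.Quadratic) ∧ f.size ≤ e.size := by
  intro f hf
  obtain ⟨j, -, hf⟩ := mem_processedEq.mp hf
  exact reachEq_bounds he j f hf

/-- If layer `i` brings nothing new, the union of the layers before `i` is closed under the rules: a
successor of layer `j < i` lies in layer `j + 1`, which is earlier than `i` or is `i` itself. -/
theorem reachEq_subset_of_subset {e : WordEquation S V} {i : ℕ}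
    (h : reachEq e i ⊆ processedEq e i) (n : ℕ) : reachEq e n ⊆ processedEq e i := by
  induction n with
  | zero =>
    rcases Nat.eq_zero_or_pos i with rfl | hi
    · exact h
    · exact fun f hf => mem_processedEq.mpr ⟨0, hi, hf⟩
  | succ n ih =>
    rw [reachEq_succ]
    rintro f ⟨g, hg, hn⟩
    obtain ⟨j, hj, hg⟩ := mem_processedEq.mp (ih hg)
    have hf : f ∈ reachEq e (j + 1) := by
      rw [reachEq_succ]
      exact ⟨g, hg, hn⟩
    rcases Nat.lt_or_ge (j + 1) i with hlt | hge
    · exact mem_processedEq.mpr ⟨j + 1, hlt, hf⟩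
    · obtain rfl : j + 1 = i := by omega
      exact h hf

end Nielsen

/-! ### Runs of the algorithm -/

section Runs

/-- At rank 0 no step is possible, so progress forces the goal. Elsewhere every step, whichever is
chosen, keeps the invariant and lowers the rank. -/
theorem inevitableWithin_of_rank {σ : Type*} {step : σ → σ → Prop} {G Inv : σ → Prop}
    (rank : σ → ℕ) (hstep : ∀ s t, Inv s → step s t → Inv t ∧ rank t < rank s)
    (hprog : ∀ s, Inv s → G s ∨ ∃ t, step s t) (n : ℕ) (s : σ) (hs : Inv s) (hn : rank s ≤ n) :
    InevitableWithin step G n s := by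
  induction n generalizing s with
  | zero =>
    obtain h | ⟨t, ht⟩ := hprog s hs
    · exact h
    · have := (hstep s t hs ht).2
      omega
  | succ n ih =>
    refine (hprog s hs).imp_right fun h => ⟨h, fun t ht => ?_⟩
    obtain ⟨h1, h2⟩ := hstep s t hs ht
    exact ih t h1 (by omega)

variable {S : Type*} {V : Type*} [DecidableEq S] [DecidableEq V]

/-- The list `[reach (n-1), …, reach 0]`. -/
def previousSets (e : WordEquation S V) : ℕ → List (Set (List (Track S V)))
  | 0 => []
  | n + 1 => encodeSet (reachEq e n) :: previousSets e n

theorem length_previousSets (e : WordEquation S V) (n : ℕ) : (previousSets e n).length = n := by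
  induction n with
  | zero => rfl
  | succ n ih => rw [previousSets, List.length_cons, ih]

theorem cons_eq_previousSets {e : WordEquation S V} {n : ℕ} {R : Set (List (Track S V))}
    {L : List (Set (List (Track S V)))} (h : R :: L = previousSets e n) :
    ∃ m, n = m + 1 ∧ R = encodeSet (reachEq e m) ∧ L = previousSets e m := by
  cases n with
  | zero => simp [previousSets] at h
  | succ m => exact ⟨m, rfl, (List.cons.inj h).1, (List.cons.inj h).2⟩

/-- The invariant of the algorithm for the equation `e`. -/
def AlgInvariant (e : WordEquation S V) : AlgState S V → Prop
  | .loop processed reach previous => ∃ i, processed = encodeSet (processedEq e i) ∧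
      reach = encodeSet (reachEq e i) ∧ previous = previousSets e i ∧
      i ≤ (processedEq e i).ncard ∧ ⟨[], []⟩ ∉ processedEq e i
  | .extract I w previous => ∃ i, previous = previousSets e i ∧
      ∃ f ∈ reachEq e i, w ∈ encode f ∧ IsNarrowModel f I
  | .chooseRule I w' w previous => ∃ i, previous = previousSets e i ∧
      (∃ f ∈ reachEq e i, w' ∈ encode f) ∧ w ∈ satur (image ruleTrans {w'}) ∧
      IsNarrowModel (decode w) I
  | .returned (some I) => IsModel e I
  | .returned none => ∃ i, reachEq e i ⊆ processedEq e i ∧ ⟨[], []⟩ ∉ processedEq e i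

theorem algInvariant_start (e : WordEquation S V) : AlgInvariant e (equationProblem e).start := by
  have hempty : processedEq e 0 = ∅ := by simp [processedEq]
  refine ⟨0, ?_, ?_, rfl, Nat.zero_le _, ?_⟩
  · simp [hempty, encodeSet]
  · change encode e = encodeSet {e.trim}
    simp [encodeSet, encode_trim]
  · simp [hempty]

variable [Finite S] [Finite V]

theorem finite_reachEq {e : WordEquation S V} (he : e.Quadratic) (n : ℕ) : (reachEq e n).Finite :=
  (finite_setOf_size_le e.size).subset fun f hf => (reachEq_bounds he n f hf).2

theorem finite_processedEq {e : WordEquation S V} (he : e.Quadratic) (n : ℕ) :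
    (processedEq e n).Finite :=
  (finite_setOf_size_le e.size).subset fun f hf => (processedEq_bounds he n f hf).2

theorem AlgInvariant.step {e : WordEquation S V} (he : e.Quadratic) {s t : AlgState S V}
    (hs : AlgInvariant e s) (hst : AlgStep (equationProblem e) s t) : AlgInvariant e t := by
  have hred : ∀ i, ∀ f ∈ reachEq e i, f.Reduced := fun i f hf => (reachEq_bounds he i f hf).1.1
  have hredp : ∀ i, ∀ f ∈ processedEq e i, f.Reduced :=
    fun i f hf => (processedEq_bounds he i f hf).1.1
  cases hst with
  | exhausted h =>
    obtain ⟨i, rfl, rfl, -, -, hnil⟩ := hs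
    exact ⟨i, (encodeSet_subset_iff (hred i) (hredp i)).mp h, hnil⟩
  | found _ h =>
    obtain ⟨i, rfl, rfl, rfl, -, -⟩ := hs
    obtain ⟨⟨k, rfl⟩, h⟩ := h
    obtain ⟨rfl, hnil⟩ := (replicate_mem_encodeSet_iff (hred i)).mp h
    exact ⟨i, rfl, _, hnil, by rw [encode_nil_nil]; rfl, rfl, fun _ _ => rfl⟩
  | advance hsub hdest =>
    obtain ⟨i, rfl, rfl, rfl, hcard, hnil⟩ := hs
    rw [encodeSet_subset_iff (hred i) (hredp i)] at hsub
    have hnil' : ⟨[], []⟩ ∉ reachEq e i := fun h =>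
      hdest ⟨[], ⟨0, rfl⟩, (replicate_mem_encodeSet_iff (hred i) (k := 0)).mpr ⟨rfl, h⟩⟩
    refine ⟨i + 1, ?_, ?_, rfl, ?_, ?_⟩
    · rw [processedEq_succ, encodeSet, encodeSet, encodeSet, Set.biUnion_union]
    · rw [reachEq_succ, ← satur_image_encodeSet fun f hf => (reachEq_bounds he i f hf).1]
      rfl
    -- The failed inclusion provides an equation not processed before, so the number of processed
    -- equations keeps up with the number of rounds.
    · refine Nat.lt_of_le_of_lt hcard (Set.ncard_lt_ncard ?_ (finite_processedEq he (i + 1)))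
      rw [processedEq_succ]
      exact ⟨Set.subset_union_left, fun h => hsub fun f hf => h (Or.inr hf)⟩
    · rw [processedEq_succ]
      exact fun h => h.elim hnil hnil'
  | back hw' hw =>
    obtain ⟨i, hprev, f, hf, hwf, hI⟩ := hs
    obtain ⟨j, rfl, rfl, rfl⟩ := cons_eq_previousSets hprev
    refine ⟨j, rfl, mem_encodeSet.mp hw', hw, ?_⟩
    -- After this choice the invariant no longer names the equation of `w`; `decode w` stands for
    -- it.
    rwa [decode_of_mem_encode (hred _ f hf) hwf]
  | rule h =>
    obtain ⟨i, rfl, ⟨f, hf, hwf⟩, -, hI⟩ := hs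
    obtain ⟨g, g', hg, hwg, hn, hwg'⟩ := h
    obtain ⟨⟨hr, hq⟩, -⟩ := reachEq_bounds he i f hf
    -- `w'` encodes only one reduced equation, so the equation that justifies the chosen rule is the
    -- reachable one, however the rule was chosen.
    obtain rfl : g = f := by
      rw [← decode_of_mem_encode hg hwg, decode_of_mem_encode hr hwf]
    rw [decode_of_mem_encode hn.reduced hwg'] at hI
    exact ⟨i, rfl, g, hf, hwf, hn.isNarrowModel hr hq hI⟩
  | finish =>
    obtain ⟨i, hprev, f, hf, -, hI⟩ := hs
    cases i with
    | zero =>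
      obtain rfl : f = e.trim := hf
      exact isModel_trim_iff.mp hI.1
    | succ i => simp [previousSets] at hprev

omit [Finite S] [Finite V] in
theorem AlgInvariant.progress {e : WordEquation S V} (he : e.Quadratic) {s : AlgState S V}
    (hs : AlgInvariant e s) :
    (∃ result, s = .returned result) ∨ ∃ t, AlgStep (equationProblem e) s t := by
  cases s with
  | loop processed reach previous =>
    right
    by_cases h : reach ⊆ processed
    · exact ⟨_, .exhausted h⟩
    · by_cases hd : ((equationProblem e).dest ∩ reach).Nonempty
      · obtain ⟨w, hw⟩ := hd
        exact ⟨_, .found h hw⟩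
      · exact ⟨_, .advance h hd⟩
  | extract I w previous =>
    right
    obtain ⟨i, rfl, f, hf, hw, -⟩ := hs
    cases i with
    | zero => exact ⟨_, .finish⟩
    | succ i =>
      rw [reachEq_succ] at hf
      obtain ⟨g, hg, ρ, hn⟩ := hf
      obtain ⟨⟨hr, hq⟩, -⟩ := reachEq_bounds he i g hg
      obtain ⟨w', hw', h⟩ := exists_mem_satur hr hq hn hw
      exact ⟨_, .back (mem_encodeSet.mpr ⟨g, hg, hw'⟩) h⟩
  | chooseRule I w' w previous =>
    right
    obtain ⟨i, rfl, ⟨f, hf, hw'⟩, h, -⟩ := hs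
    obtain ⟨⟨hr, hq⟩, -⟩ := reachEq_bounds he i f hf
    obtain ⟨ρ, e', hn, hw⟩ := mem_encode_of_mem_satur hr hq hw' h
    exact ⟨_, .rule ⟨f, e', hr, hw', hn, hw⟩⟩
  | returned result => exact Or.inl ⟨result, rfl⟩

omit [DecidableEq S] [DecidableEq V] [Finite S] [Finite V] in
/-- A bound for the number of remaining steps, if `K` bounds the number of iterations. -/
def AlgState.rank (K : ℕ) : AlgState S V → ℕ
  | .loop _ _ previous => (K - previous.length) + 2 * K + 3
  | .chooseRule _ _ _ previous => 2 * previous.length + 2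
  | .extract _ _ previous => 2 * previous.length + 1
  | .returned _ => 0

theorem AlgInvariant.length_le {e : WordEquation S V} (he : e.Quadratic)
    {processed reach : Set (List (Track S V))} {previous : List (Set (List (Track S V)))}
    (hs : AlgInvariant e (.loop processed reach previous)) :
    previous.length ≤ {f : WordEquation S V | f.size ≤ e.size}.ncard := by
  obtain ⟨i, -, -, rfl, hcard, -⟩ := hs
  rw [length_previousSets]
  exact hcard.trans (Set.ncard_le_ncard (fun f hf => (processedEq_bounds he i f hf).2)
    (finite_setOf_size_le e.size))

/-- Each level of the extraction takes two steps, and the last step returns; the loop reserves `2 *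
K + 3` for this, since at most `K` levels have been stored. -/
theorem AlgInvariant.rank_lt {e : WordEquation S V} (he : e.Quadratic) {s t : AlgState S V}
    (hs : AlgInvariant e s) (hst : AlgStep (equationProblem e) s t) :
    t.rank {f : WordEquation S V | f.size ≤ e.size}.ncard <
      s.rank {f : WordEquation S V | f.size ≤ e.size}.ncard := by
  have ht := hs.step he hst
  cases hst with
  | exhausted _ => simp [AlgState.rank]
  | found _ _ =>
    have := hs.length_le he
    simp only [AlgState.rank]
    omega
  | advance _ _ =>
    -- The bound is needed for the state after the step: it shows that the truncated difference `K -
    -- previous.length` really decreases.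
    have := ht.length_le he
    simp only [AlgState.rank, List.length_cons] at this ⊢
    omega
  | back _ _ => simp only [AlgState.rank, List.length_cons]; omega
  | rule _ => simp only [AlgState.rank]; omega
  | finish => simp [AlgState.rank]

theorem algInvariant_of_reflTransGen {e : WordEquation S V} (he : e.Quadratic) {s : AlgState S V}
    (h : Relation.ReflTransGen (AlgStep (equationProblem e)) (equationProblem e).start s) :
    AlgInvariant e s := by
  induction h with
  | refl => exact algInvariant_start e
  | tail _ hst ih => exact ih.step he hst

theorem inevitableWithin_equationProblem {e : WordEquation S V} (he : e.Quadratic)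
    {G : AlgState S V → Prop} (hG : ∀ result, AlgInvariant e (.returned result) →
      G (.returned result)) :
    ∃ n, InevitableWithin (AlgStep (equationProblem e)) G n (equationProblem e).start := by
  refine ⟨_, inevitableWithin_of_rank (Inv := AlgInvariant e)
    (AlgState.rank {f : WordEquation S V | f.size ≤ e.size}.ncard)
    (fun s t hs hst => ⟨hs.step he hst, hs.rank_lt he hst⟩) (fun s hs => ?_) _ _
    (algInvariant_start e) le_rfl⟩
  obtain ⟨result, rfl⟩ | h := hs.progress he
  · exact Or.inl (hG result hs)
  · exact Or.inr h

/-! ### The properties of the instantiation -/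

theorem isEffective_equationProblem (e : WordEquation S V) :
    (equationProblem e).IsEffective :=
  ⟨isRegularSet_encode e, isRational_exists_tPrepend 2, isRational_exists_tErase 2, by
    simpa [equationProblem] using
      isRegularSet_append_replicate ([] : List (Track S V)) pad2⟩

theorem symbolic_equationProblem {e : WordEquation S V} (he : e.Quadratic) :
    (equationProblem e).Symbolic := by
  intro processed reach previous h
  obtain ⟨i, rfl, rfl, rfl, -, -⟩ := algInvariant_of_reflTransGen he h
  refine ⟨isRegularSet_encodeSet (finite_processedEq he i),
    isRegularSet_encodeSet (finite_reachEq he i), ?_⟩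
  clear h
  induction i with
  | zero => simp [previousSets]
  | succ i ih =>
    intro R hR
    obtain rfl | hR := List.mem_cons.mp hR
    · exact isRegularSet_encodeSet (finite_reachEq he i)
    · exact ih R hR

theorem sound_equationProblem {e : WordEquation S V} (he : e.Quadratic) :
    (equationProblem e).Sound (IsModel e) :=
  fun _ h => algInvariant_of_reflTransGen he h

theorem terminating_equationProblem {e : WordEquation S V} (he : e.Quadratic) :
    (equationProblem e).Terminating :=
  inevitableWithin_equationProblem he fun result _ => ⟨result, rfl⟩

theorem complete_equationProblem {e : WordEquation S V} (he : e.Quadratic) :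
    (equationProblem e).Complete (IsModel e) := by
  rintro ⟨J, hJ⟩
  refine inevitableWithin_equationProblem he ?_
  rintro (_ | I) h
  -- Returning `false` means that the processed equations contain all reachable ones but not the
  -- trivial one, which a model makes reachable.
  · obtain ⟨i, hsub, hnil⟩ := h
    have := Fintype.ofFinite V
    obtain ⟨n, hn⟩ := exists_nil_mem_reachEq he hJ
    exact absurd (reachEq_subset_of_subset hsub n hn) hnil
  · exact ⟨I, rfl, h⟩

end Runs

end WordEq

theorem mainTheorem2 {S : Type*} {V : Type*} [Fintype S] [Fintype V]
    [DecidableEq S] [DecidableEq V] (e : WordEq.WordEquation S V) (he : e.Quadratic) :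
    (WordEq.equationProblem e).IsEffective ∧
      (WordEq.equationProblem e).Symbolic ∧
      (WordEq.equationProblem e).Sound (WordEq.IsModel e) ∧
      (WordEq.equationProblem e).Complete (WordEq.IsModel e) ∧
      (WordEq.equationProblem e).Terminating :=
  ⟨WordEq.isEffective_equationProblem e, WordEq.symbolic_equationProblem he,
    WordEq.sound_equationProblem he, WordEq.complete_equationProblem he,
    WordEq.terminating_equationProblem he⟩
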